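/- Let $t,r\ge 1$, $m=t+r<N\le K$ be integers, and split the $N$ coordinates of $\mathbb C^N$ into three blocks of sizes $t$, $r$, $N-t-r$. Let $\boldsymbol n,\boldsymbol n_1,\dots,\boldsymbol n_K$ be iid complex normal random vectors in $\mathbb C^N$ with zero mean and positive definite covariance matrix $\boldsymbol M=(\boldsymbol M_{ij})_{i,j=1,2,3}$. The secondary data are $\boldsymbol z_k=\boldsymbol n_k$, $k=1,\dots,K$, and $\boldsymbol S=\sum_{k=1}^K\boldsymbol z_k\boldsymbol z_k^\dagger=(\boldsymbol S_{ij})$. The primary datum $\boldsymbol z=(\boldsymbol z_1,\boldsymbol z_2,\boldsymbol z_3)$ is $$H_0:\ \boldsymbol z=(\boldsymbol\theta_{10},\boldsymbol 0,\boldsymbol 0)+\boldsymbol n,\qquad H_1:\ \boldsymbol z=(\boldsymbol\theta_{11},\boldsymbol\theta_2,\boldsymbol 0)+\boldsymbol n,$$ with $\boldsymbol\theta_{10},\boldsymbol\theta_{11}\in\mathbb C^t$ and $\boldsymbol 0\ne\boldsymbol\theta_2\in\mathbb C^r$. Put $\boldsymbol z_{2.3}=\boldsymbol z_2-\boldsymbol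 S_{23}\boldsymbol S_{33}^{-1}\boldsymbol z_3$, $\boldsymbol S_{2.3}=\boldsymbol S_{22}-\boldsymbol S_{23}\boldsymbol S_{33}^{-1}\boldsymbol S_{32}$, $m_1=\boldsymbol z_{2.3}^\dagger\boldsymbol S_{2.3}^{-1}\boldsymbol z_{2.3}$, $m_2=\boldsymbol z_3^\dagger\boldsymbol S_{33}^{-1}\boldsymbol z_3$, $$p_1=\frac1{1+\frac{m_1}{1+m_2}},\qquad p_2=\frac1{1+m_2},\qquad \mathrm{SINR}=\boldsymbol\theta_2^\dagger(\boldsymbol M_{22}-\boldsymbol M_{23}\boldsymbol M_{33}^{-1}\boldsymbol M_{32})^{-1}\boldsymbol\theta_2 .$$ Let $\mathcal C\chi^2_n(\delta)$ be the law of $\sum_{k=1}^n|x_k|^2$ for independent $x_k\sim\mathcal{CN}(\mu_k,1)$ with $\sum_k|\mu_k|^2=\delta^2$. Let $\mathcal C\beta_{n,m}(\delta)$, the complex beta distribution with $n,m$ complex degrees of freedom and noncentrality parameter $\delta$ (central if $\delta=0$), be the law of $1/(1+a/b)$ for independent $a\sim\mathcal C\chi^2_m(\delta)$, $b\sim\mathcal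 C\chi^2_n(0)$. For $\delta=0$ its pdf on $(0,1]$ is $f_\beta(x;n,m,0)=\frac{(n+m-1)!}{(n-1)!\,(m-1)!}x^{n-1}(1-x)^{m-1}$. Write $L=K-(N-t)+1$. Then: 1. The joint law of $(p_1,p_2)$ has a density with respect to Lebesgue measure, vanishing outside $(0,1]\times(0,1]$ and given for $(x,y)\in(0,1]\times(0,1]$ by $$f_{p_1,p_2}(x,y;H_0)=f_\beta(x;L,r,0)\,f_\beta(y;L+r,N-t-r,0),$$ $$f_{p_1,p_2}(x,y;H_1)=f_\beta(x;L,r,0)\,f_\beta(y;L+r,N-t-r,0)\;e^{-\mathrm{SINR}\,xy}\sum_{k=0}^{L}\binom{L}{k}\frac{(r-1)!}{(r+k-1)!}\,[\mathrm{SINR}\,y(1-x)]^k .$$ 2. Under both $H_0$ and $H_1$, $p_2\sim\mathcal C\beta_{L+r,\,N-t-r}(0)$; in particular $p_2$ is ancillary. 3. The conditional law of $p_1$ given $p_2=y$ is, for almost every $y$ with respect to the law of $p_2$, $\mathcal C\beta_{L,r}(0)$ under $H_0$ and $\mathcal C\beta_{L,r}(\delta)$ with $\delta^2=\mathrm{SINR}\cdot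 y$ under $H_1$. -/

import Mathlib

open MeasureTheory ProbabilityTheory
open scoped Matrix ComplexOrder Nat

noncomputable section

/-- The (real) value of the Hermitian quadratic form `v† A v`. -/
def hermForm {ι : Type*} [Fintype ι] (A : Matrix ι ι ℂ) (v : ι → ℂ) : ℝ :=
  (star v ⬝ᵥ (A *ᵥ v)).re

/-- The (circularly symmetric) complex normal distribution with mean `μ` and positive definite
covariance matrix `M`: its density with respect to Lebesgue measure on `ℂ^ι` is
`exp (-(x - μ)† M⁻¹ (x - μ)) / (π ^ |ι| * det M)`. -/
def complexNormal {ι : Type*} [Fintype ι] [DecidableEq ι] (μ : ι → ℂ) (M : Matrix ι ι ℂ) :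
    Measure (ι → ℂ) :=
  (volume : Measure (ι → ℂ)).withDensity fun x =>
    ENNReal.ofReal (Real.exp (-hermForm M⁻¹ (x - μ)) / (Real.pi ^ Fintype.card ι * M.det.re))

/-- The complex chi-square distribution with `n ≥ 1` complex degrees of freedom and noncentrality
parameter `δ`: the law of `∑ k, |x k| ^ 2` for independent `x k ∼ CN(μ k, 1)` with
`∑ k, |μ k| ^ 2 = δ ^ 2` (the law depends on the means through this sum only; here the mean vector
is `δ` times the first basis vector). It is central for `δ = 0`. -/
def complexChiSq (n : ℕ) (δ : ℝ) : Measure ℝ :=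
  (complexNormal (fun k : Fin n => if (k : ℕ) = 0 then (δ : ℂ) else 0) 1).map
    fun x => ∑ k, ‖x k‖ ^ 2

/-- The complex F-distribution with `n, m` complex degrees of freedom and noncentrality parameter
`δ`: the law of `a / b` for independent `a ∼ Cχ²_n(δ)` and `b ∼ Cχ²_m(0)`. -/
def complexF (n m : ℕ) (δ : ℝ) : Measure ℝ :=
  ((complexChiSq n δ).prod (complexChiSq m 0)).map fun p => p.1 / p.2

/-- The complex beta distribution with `n, m` complex degrees of freedom and noncentrality parameter
`δ`: the law of `1 / (1 + f)` for `f ∼ CF_{m,n}(δ)`. It is central for `δ = 0`. -/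
def complexBeta (n m : ℕ) (δ : ℝ) : Measure ℝ :=
  (complexF m n δ).map fun x => 1 / (1 + x)

/-- The density at `x ∈ (0, 1]` of the complex central beta distribution with `n, m ≥ 1` complex
degrees of freedom. -/
def complexBetaPdf (n m : ℕ) (x : ℝ) : ℝ :=
  (n + m - 1)! / ((n - 1)! * (m - 1)!) * x ^ (n - 1) * (1 - x) ^ (m - 1)

/-- The exponential times finite sum factor, with `n, r` complex degrees of freedom and
signal-to-noise-plus-interference ratio `sinr`. -/
def sinrFactor (n r : ℕ) (sinr x y : ℝ) : ℝ :=
  Real.exp (-(sinr * x * y)) *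
    ∑ k ∈ Finset.range (n + 1),
      (n.choose k : ℝ) * ((r - 1)! / (r + k - 1)!) * (sinr * y * (1 - x)) ^ k

/-- The measure on `ℝ × ℝ` with Lebesgue density `f x y` on `(0, 1] × (0, 1]` and `0` elsewhere. -/
def unitSquareDensity (f : ℝ → ℝ → ℝ) : Measure (ℝ × ℝ) :=
  (volume : Measure (ℝ × ℝ)).withDensity
    ((Set.Ioc 0 1 ×ˢ Set.Ioc 0 1).indicator fun p => ENNReal.ofReal (f p.1 p.2))

/-- The `N` channels, split into blocks of sizes `t`, `r` and `N - (t + r)`. -/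
abbrev Channel (N t r : ℕ) : Type := Fin t ⊕ Fin r ⊕ Fin (N - (t + r))

namespace Channel

variable {N t r : ℕ}

/-- The inclusion of the second block. -/
def two (j : Fin r) : Channel N t r := Sum.inr (Sum.inl j)

/-- The inclusion of the third block. -/
def three (j : Fin (N - (t + r))) : Channel N t r := Sum.inr (Sum.inr j)

/-- The vector `E_t θ₁ + E_r θ₂`, with blocks `θ₁`, `θ₂` and `0`. -/
def mean (θ₁ : Fin t → ℂ) (θ₂ : Fin r → ℂ) : Channel N t r → ℂ :=
  Sum.elim θ₁ (Sum.elim θ₂ 0)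

/-- `A₂.₃ = A₂₂ - A₂₃ A₃₃⁻¹ A₃₂`. -/
def schur (A : Matrix (Channel N t r) (Channel N t r) ℂ) : Matrix (Fin r) (Fin r) ℂ :=
  A.submatrix two two - A.submatrix two three * (A.submatrix three three)⁻¹ * A.submatrix three two

/-- The matrix `S = Z Z†`, where the columns of `Z` are the secondary data `zs 1, …, zs K`. -/
def scatter {K : ℕ} (zs : Fin K → Channel N t r → ℂ) :
    Matrix (Channel N t r) (Channel N t r) ℂ :=
  (Matrix.of fun i k => zs k i) * (Matrix.of fun i k => zs k i)ᴴ

/-- `z₂.₃ = z₂ - S₂₃ S₃₃⁻¹ z₃`. -/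
def resid (z : Channel N t r → ℂ) (S : Matrix (Channel N t r) (Channel N t r) ℂ) : Fin r → ℂ :=
  (fun j => z (two j)) -
    (S.submatrix two three * (S.submatrix three three)⁻¹) *ᵥ fun j => z (three j)

/-- The first component `m₁ = z₂.₃† S₂.₃⁻¹ z₂.₃` of the maximal invariant. -/
def m₁ (z : Channel N t r → ℂ) (S : Matrix (Channel N t r) (Channel N t r) ℂ) : ℝ :=
  hermForm (schur S)⁻¹ (resid z S)

/-- The second component `m₂ = z₃† S₃₃⁻¹ z₃` of the maximal invariant. -/
def m₂ (z : Channel N t r → ℂ) (S : Matrix (Channel N t r) (Channel N t r) ℂ) : ℝ :=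
  hermForm (S.submatrix three three)⁻¹ fun j => z (three j)

/-- The first component of the transformed maximal invariant. -/
def p₁ (z : Channel N t r → ℂ) (S : Matrix (Channel N t r) (Channel N t r) ℂ) : ℝ :=
  1 / (1 + m₁ z S / (1 + m₂ z S))

/-- The second component of the transformed maximal invariant. -/
def p₂ (z : Channel N t r → ℂ) (S : Matrix (Channel N t r) (Channel N t r) ℂ) : ℝ :=
  1 / (1 + m₂ z S)

/-- `SINR = θ₂† (M₂₂ - M₂₃ M₃₃⁻¹ M₃₂)⁻¹ θ₂`. -/
def SINR (θ₂ : Fin r → ℂ) (M : Matrix (Channel N t r) (Channel N t r) ℂ) : ℝ :=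
  hermForm (schur M)⁻¹ θ₂

end Channel

end

/-!
The statistics `p₁`, `p₂` only involve the second and third blocks of the data, and they are
invariant under `z ↦ T z`, `S ↦ T S T†` for block upper triangular `T` (`Channel.m₁_congr`,
`Channel.m₂_congr`). Factoring the covariance matrix as `M = T T†` with such a `T`
(`Channel.exists_upperTriangular`), the noise may be assumed to have identity covariance; the mean
of the second block then becomes a vector `v` with `|v|² = SINR`, and that of the third block stays
zero. The first block, hence the interference `θ₁`, plays no further role.

In this whitened model `m₂` is a central Hotelling statistic, a ratio of independent complex
chi-square variables. Conditionally on the third block, put `P = 1 - Z₃† (Z₃ Z₃†)⁻¹ Z₃`, the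
projection onto the kernel of `Z₃`. Then `S₂.₃ = Z₂ P Z₂†`, while the residual `z₂.₃` is a
combination of the vector `z₂` and the columns of `Z₂` with coefficients `(1, -Z₃† (Z₃ Z₃†)⁻¹ z₃)`.
These coefficients are orthogonal to the kernel of `Z₃` and have squared length `1 + m₂`
(`exists_residual_basis`). By unitary invariance, `z₂.₃ / √(1 + m₂)` is complex normal with mean
`v / √(1 + m₂)` and identity covariance, independently of `S₂.₃`, which is a Gram matrix of `K - s`
standard vectors, `s` being the size of the third block. So `m₁ / (1 + m₂)` is, conditionally, a
noncentral Hotelling statistic with `δ² = SINR · p₂` (`gaussianArray_map_residual`). This gives the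
joint law as a composition of the law of `p₂` with a Markov kernel (`gaussianArray_map_whitened`,
`Channel.map_p₂_p₁`), from which all the claims are read off.

The law of the Hotelling statistic (`map_hermForm_inv_gram`) follows by rotating the vector to a
multiple of the first basis vector: the corresponding entry of the inverse Gram matrix is the
inverse squared length of the component of one row orthogonal to the others. The density of the
noncentral complex Beta law (`complexBeta_eq_withDensity`) comes from writing the noncentral
chi-square law as a Poisson mixture of Gamma laws (`complexNormal_map_normSq`, by characteristic
functions) and summing the resulting series of Beta densities by Kummer's transformation
(`hasSum_kummer`), which turns it into an exponential times a polynomial.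

The normalizing constant of the noise density is never computed: a probability measure whose density
is known up to a constant is determined (`HasGibbsDensity.eq`), and linear maps transport such
measures without any Jacobian being needed (`HasGibbsDensity.map_linear`).
-/

/-! ### Densities known up to normalization, and the complex normal law -/

/-- `μ` is a probability measure on `E` whose Lebesgue density is proportional to `exp (-q)`. The
constant is left implicit: it is determined by the total mass. -/
structure HasGibbsDensity {E : Type*} [MeasureSpace E] (μ : Measure E) (q : E → ℝ) : Prop where
  isProbabilityMeasure : IsProbabilityMeasure μ
  measurable : Measurable q
  exists_eq : ∃ c : ℝ, 0 ≤ c ∧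
    μ = (volume : Measure E).withDensity fun x => ENNReal.ofReal (c * Real.exp (-q x))

lemma Measure.map_withDensity_comp {E F : Type*} [MeasurableSpace E] [MeasurableSpace F]
    (ν : Measure E) {f : E → F} (hf : Measurable f) {g : F → ENNReal} (hg : Measurable g) :
    (ν.withDensity (g ∘ f)).map f = (ν.map f).withDensity g := by
  ext s hs
  rw [Measure.map_apply hf hs, withDensity_apply _ (hf hs), withDensity_apply _ hs,
    setLIntegral_map hs hg hf]
  rfl

/-- A product of measures with densities has the product density. -/
lemma Measure.pi_withDensity_ofReal {ι : Type*} [Fintype ι] {E : ι → Type*}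
    [∀ i, MeasurableSpace (E i)] {ν : ∀ i, Measure (E i)} [∀ i, SigmaFinite (ν i)]
    {f : ∀ i, E i → ℝ} (hf : ∀ i, Integrable (f i) (ν i)) (h0 : ∀ i x, 0 ≤ f i x) :
    Measure.pi (fun i => (ν i).withDensity fun x => ENNReal.ofReal (f i x)) =
      (Measure.pi ν).withDensity fun x => ENNReal.ofReal (∏ i, f i (x i)) := by
  have : ∀ i, SigmaFinite ((ν i).withDensity fun x => ENNReal.ofReal (f i x)) := fun i =>
    SigmaFinite.withDensity_ofReal _
  refine Measure.pi_eq fun s hs => ?_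
  rw [withDensity_apply _ (.univ_pi hs), Measure.restrict_pi_pi,
    ← ofReal_integral_eq_lintegral_ofReal, integral_fintype_prod_eq_prod,
    ENNReal.ofReal_prod_of_nonneg fun i _ => integral_nonneg fun x => h0 i x]
  · refine Finset.prod_congr rfl fun i _ => ?_
    rw [withDensity_apply _ (hs i), ofReal_integral_eq_lintegral_ofReal
      (hf i).integrableOn (.of_forall fun x => h0 i x)]
  · exact Integrable.fintype_prod_dep fun i => (hf i).integrableOn
  · exact .of_forall fun x => Finset.prod_nonneg fun i _ => h0 i _

namespace HasGibbsDensity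

variable {E F : Type*} [MeasureSpace E] [MeasureSpace F] {μ ν : Measure E} {q : E → ℝ}

/-- A probability measure is determined by its density up to a constant factor. -/
lemma eq (hμ : HasGibbsDensity μ q) (hν : HasGibbsDensity ν q) : μ = ν := by
  obtain ⟨c, hc, h⟩ := hμ.exists_eq
  obtain ⟨d, hd, h'⟩ := hν.exists_eq
  have := hμ.isProbabilityMeasure
  have := hν.isProbabilityMeasure
  have key : ∀ (ρ : Measure E) [IsProbabilityMeasure ρ] (c : ℝ), 0 ≤ c →
      ρ = (volume : Measure E).withDensity (fun x => ENNReal.ofReal (c * Real.exp (-q x))) →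
      ENNReal.ofReal c = (∫⁻ x, ENNReal.ofReal (Real.exp (-q x)))⁻¹ := by
    intro ρ _ c hc h
    have h1 : ρ Set.univ = 1 := measure_univ
    rw [h, withDensity_apply _ MeasurableSet.univ, Measure.restrict_univ] at h1
    simp_rw [ENNReal.ofReal_mul hc] at h1
    rw [lintegral_const_mul] at h1
    · exact ENNReal.eq_inv_of_mul_eq_one_left h1
    · exact (Real.measurable_exp.comp hμ.measurable.neg).ennreal_ofReal
  have hcd : c = d := by
    have := (key μ c hc h).trans (key ν d hd h').symm
    rwa [ENNReal.ofReal_eq_ofReal_iff hc hd] at this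
  rw [h, h', hcd]

lemma map (hμ : HasGibbsDensity μ q) {f : E → F} (hf : Measurable f) {c : NNReal}
    (hv : (volume : Measure E).map f = c • (volume : Measure F)) {q' : F → ℝ}
    (hq' : Measurable q') (hq : ∀ x, q' (f x) = q x) : HasGibbsDensity (μ.map f) q' := by
  obtain ⟨d, hd, h⟩ := hμ.exists_eq
  have := hμ.isProbabilityMeasure
  refine ⟨Measure.isProbabilityMeasure_map hf.aemeasurable, hq', c * d, by positivity, ?_⟩
  have hm : Measurable fun y => ENNReal.ofReal (d * Real.exp (-q' y)) :=
    ((Real.measurable_exp.comp hq'.neg).const_mul _).ennreal_ofReal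
  have h2 : (fun x => ENNReal.ofReal (d * Real.exp (-q x)))
      = (fun y => ENNReal.ofReal (d * Real.exp (-q' y))) ∘ f := by
    ext x; simp [hq]
  rw [h, h2, Measure.map_withDensity_comp _ hf hm, hv]
  ext s hs
  rw [withDensity_apply _ hs, withDensity_apply _ hs, Measure.restrict_smul]
  rw [show c • (volume : Measure F).restrict s = (c : ENNReal) • (volume : Measure F).restrict s
    from rfl, lintegral_smul_measure, smul_eq_mul, ← lintegral_const_mul _ hm]
  refine lintegral_congr fun y => ?_
  rw [mul_assoc, ENNReal.ofReal_mul (p := (c : ℝ)) c.2, ENNReal.ofReal_coe_nnreal]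

lemma pi {ι : Type*} [Fintype ι] {E : ι → Type*} [∀ i, MeasureSpace (E i)]
    [∀ i, SigmaFinite (volume : Measure (E i))]
    {μ : ∀ i, Measure (E i)} {q : ∀ i, E i → ℝ} (h : ∀ i, HasGibbsDensity (μ i) (q i)) :
    HasGibbsDensity (Measure.pi μ) fun x => ∑ i, q i (x i) := by
  choose c hc hμ using fun i => (h i).exists_eq
  have hp := fun i => (h i).isProbabilityMeasure
  have hqm := fun i => (h i).measurable
  have hm : ∀ i, Measurable fun x => c i * Real.exp (-q i x) := fun i =>
    (Real.measurable_exp.comp (hqm i).neg).const_mul _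
  have hint : ∀ i, Integrable (fun x => c i * Real.exp (-q i x)) := by
    intro i
    refine ⟨(hm i).aestronglyMeasurable, ?_⟩
    rw [hasFiniteIntegral_iff_ofReal (.of_forall fun x => mul_nonneg (hc i) (Real.exp_pos _).le)]
    have h1 : μ i Set.univ = 1 := measure_univ
    rw [hμ i, withDensity_apply _ MeasurableSet.univ, Measure.restrict_univ] at h1
    rw [h1]; exact ENNReal.one_lt_top
  refine ⟨inferInstance, Finset.measurable_sum _ fun i _ => (hqm i).comp (measurable_pi_apply i),
    ∏ i, c i, Finset.prod_nonneg fun i _ => hc i, ?_⟩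
  rw [funext hμ, Measure.pi_withDensity_ofReal hint
    fun i x => mul_nonneg (hc i) (Real.exp_pos _).le, volume_pi]
  simp_rw [Finset.prod_mul_distrib, ← Real.exp_sum, Finset.sum_neg_distrib]

end HasGibbsDensity

/-- Gibbs densities are transported by linear isomorphisms; the Jacobian is absorbed by the
normalization. -/
lemma HasGibbsDensity.map_linear {E F : Type*} [NormedAddCommGroup E] [NormedSpace ℝ E]
    [MeasureSpace E] [BorelSpace E] [NormedAddCommGroup F] [NormedSpace ℝ F] [FiniteDimensional ℝ E]
    [FiniteDimensional ℝ F]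
    [MeasureSpace F] [BorelSpace F] (hE : (volume : Measure E).IsAddHaarMeasure)
    (hF : (volume : Measure F).IsAddHaarMeasure) {μ : Measure E} {q : E → ℝ}
    (hμ : HasGibbsDensity μ q) (f : E ≃ₗ[ℝ] F) {q' : F → ℝ} (hq' : Measurable q')
    (hq : ∀ x, q' (f x) = q x) : HasGibbsDensity (μ.map f) q' := by
  have h := (f.toContinuousLinearEquiv.isAddHaarMeasure_map (volume : Measure E))
  have := FiniteDimensional.proper ℝ E
  have := FiniteDimensional.proper ℝ F
  refine hμ.map f.toContinuousLinearEquiv.continuous.measurable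
    (Measure.isAddLeftInvariant_eq_smul _ _) hq' hq

instance {ι κ : Type*} [Fintype ι] [Fintype κ] :
    (volume : Measure (ι → κ → ℂ)).IsAddHaarMeasure := by
  have : (volume : Measure (κ → ℂ)).IsAddHaarMeasure := inferInstance
  exact Measure.pi.isAddHaarMeasure (fun _ : ι => (volume : Measure (κ → ℂ)))

lemma hermForm_one {ι : Type*} [Fintype ι] [DecidableEq ι] (v : ι → ℂ) :
    hermForm 1 v = ∑ i, ‖v i‖ ^ 2 := by
  simp only [hermForm, Matrix.one_mulVec, dotProduct, Complex.re_sum]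
  refine Finset.sum_congr rfl fun i _ => ?_
  simp [Pi.star_apply, ← Complex.normSq_eq_conj_mul_self, Complex.normSq_eq_norm_sq]
  norm_cast

lemma measurable_hermForm_sub {ι : Type*} [Fintype ι] (A : Matrix ι ι ℂ) (μ : ι → ℂ) :
    Measurable fun x => hermForm A (x - μ) := by
  refine Continuous.measurable ?_
  unfold hermForm Matrix.mulVec dotProduct
  fun_prop

/-- The standard complex normal distribution on the line with mean `a`. -/
noncomputable def stdComplexNormal (a : ℂ) : Measure ℂ :=
  volume.withDensity fun x => ENNReal.ofReal (Real.pi⁻¹ * Real.exp (-‖x - a‖ ^ 2))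

lemma integral_exp_neg_norm_sub_sq (a : ℂ) :
    Integrable (fun x : ℂ => Real.exp (-‖x - a‖ ^ 2)) ∧
      ∫ x : ℂ, Real.exp (-‖x - a‖ ^ 2) = Real.pi := by
  have h0 : ∫ x : ℂ, Real.exp (-‖x‖ ^ 2) = Real.pi := by
    have := Complex.integral_exp_neg_rpow (p := 2) (by norm_num)
    simpa [show (1:ℝ) + 1 = (1:ℕ) + 1 by norm_num, Real.Gamma_nat_eq_factorial] using this
  have h : ∫ x : ℂ, Real.exp (-‖x - a‖ ^ 2) = Real.pi := by
    rw [integral_sub_right_eq_self (fun x : ℂ => Real.exp (-‖x‖ ^ 2)) a, h0]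
  refine ⟨?_, h⟩
  -- the integral of a function that is not integrable would be zero
  by_contra hc
  rw [integral_undef hc] at h
  exact Real.pi_ne_zero h.symm

lemma hasGibbsDensity_stdComplexNormal (a : ℂ) :
    HasGibbsDensity (stdComplexNormal a) fun x => ‖x - a‖ ^ 2 := by
  refine ⟨⟨?_⟩, by fun_prop, _, by positivity, rfl⟩
  obtain ⟨h1, h2⟩ := integral_exp_neg_norm_sub_sq a
  rw [stdComplexNormal, withDensity_apply _ MeasurableSet.univ, Measure.restrict_univ,
    ← ofReal_integral_eq_lintegral_ofReal (h1.const_mul _) (.of_forall fun x => by positivity),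
    integral_const_mul, h2, inv_mul_cancel₀ Real.pi_ne_zero, ENNReal.ofReal_one]

instance (a : ℂ) : IsProbabilityMeasure (stdComplexNormal a) :=
  (hasGibbsDensity_stdComplexNormal a).isProbabilityMeasure

lemma complexNormal_hasGibbsDensity {ι : Type*} [Fintype ι] [DecidableEq ι] (μ : ι → ℂ)
    {M : Matrix ι ι ℂ} (hM : 0 ≤ M.det.re) (h : IsProbabilityMeasure (complexNormal μ M)) :
    HasGibbsDensity (complexNormal μ M) fun x => hermForm M⁻¹ (x - μ) := by
  refine ⟨h, measurable_hermForm_sub _ _, (Real.pi ^ Fintype.card ι * M.det.re)⁻¹, by positivity, ?_⟩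
  simp only [complexNormal, div_eq_inv_mul]

/-- The coordinates of a standard complex normal vector are independent. -/
lemma complexNormal_one_eq_pi {ι : Type*} [Fintype ι] [DecidableEq ι] (μ : ι → ℂ) :
    complexNormal μ 1 = Measure.pi fun i => stdComplexNormal (μ i) := by
  simp only [stdComplexNormal]
  rw [Measure.pi_withDensity_ofReal
    (fun i => (integral_exp_neg_norm_sub_sq (μ i)).1.const_mul _) fun i x => by positivity]
  simp only [complexNormal, inv_one, hermForm_one, Matrix.det_one, Complex.one_re, mul_one,
    div_eq_inv_mul, Pi.sub_apply, Finset.prod_mul_distrib, ← Real.exp_sum,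
    Finset.sum_neg_distrib, Finset.prod_const, Finset.card_univ, inv_pow, volume_pi]

instance {ι : Type*} [Fintype ι] [DecidableEq ι] (μ : ι → ℂ) :
    IsProbabilityMeasure (complexNormal μ 1) := by
  rw [complexNormal_one_eq_pi]; infer_instance

lemma hasGibbsDensity_complexNormal_one {ι : Type*} [Fintype ι] [DecidableEq ι] (μ : ι → ℂ) :
    HasGibbsDensity (complexNormal μ 1) fun x => ∑ i, ‖x i - μ i‖ ^ 2 := by
  rw [complexNormal_one_eq_pi]
  exact HasGibbsDensity.pi fun i => hasGibbsDensity_stdComplexNormal (μ i)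

/-! ### Gaussian arrays and their symmetries -/

/-- The law of a random array with independent standard complex normal entries: the vectors
`X k : κ → ℂ`, for `k : ι`, are independent `CN(0, 1)` vectors. -/
noncomputable def gaussianArray (ι κ : Type*) [Fintype ι] [Fintype κ] [DecidableEq κ] :
    Measure (ι → κ → ℂ) :=
  Measure.pi fun _ => complexNormal 0 1

instance {ι κ : Type*} [Fintype ι] [Fintype κ] [DecidableEq κ] :
    IsProbabilityMeasure (gaussianArray ι κ) := by
  unfold gaussianArray; infer_instance

section Symmetries

variable {ι κ J α β : Type*} [Fintype ι] [Fintype κ] [Fintype J] [Fintype α] [Fintype β]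
  [DecidableEq ι] [DecidableEq κ] [DecidableEq J] [DecidableEq α] [DecidableEq β]

lemma complexNormal_map_add (a : ι → ℂ) :
    (complexNormal (0 : ι → ℂ) 1).map (fun x => x + a) = complexNormal a 1 := by
  refine HasGibbsDensity.eq (q := fun x => ∑ i, ‖x i - a i‖ ^ 2) ?_
    (hasGibbsDensity_complexNormal_one a)
  refine (hasGibbsDensity_complexNormal_one 0).map (measurable_add_const a) (c := 1) ?_
    (by fun_prop) (by simp)
  rw [one_smul]
  exact map_add_right_eq_self volume a

omit [DecidableEq ι] in
lemma hasGibbsDensity_gaussianArray :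
    HasGibbsDensity (gaussianArray ι κ) fun X => ∑ i, ∑ k, ‖X i k‖ ^ 2 := by
  simpa using! HasGibbsDensity.pi fun _ : ι => hasGibbsDensity_complexNormal_one (0 : κ → ℂ)

lemma gaussianArray_map_swap :
    (gaussianArray ι κ).map (fun X k i => X i k) = gaussianArray κ ι := by
  let f : (ι → κ → ℂ) ≃ₗ[ℝ] (κ → ι → ℂ) :=
    { toFun := fun X k i => X i k, invFun := fun X k i => X i k
      map_add' := fun _ _ => rfl, map_smul' := fun _ _ => rfl
      left_inv := fun _ => rfl, right_inv := fun _ => rfl }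
  refine HasGibbsDensity.eq ?_ hasGibbsDensity_gaussianArray
  exact hasGibbsDensity_gaussianArray.map_linear inferInstance inferInstance f (by fun_prop)
    fun X => Finset.sum_comm

lemma complexNormal_map_inl :
    (complexNormal (0 : α ⊕ β → ℂ) 1).map (fun x a => x (Sum.inl a)) = complexNormal 0 1 := by
  simp_rw [complexNormal_one_eq_pi]
  have h := measurePreserving_sumPiEquivProdPi (fun _ : α ⊕ β => stdComplexNormal 0)
  exact (measurePreserving_fst.comp h).map_eq

/-- The coordinates of a standard complex normal vector along an orthonormal family form a standard
complex normal vector. -/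
lemma complexNormal_map_vecMul {Q : Matrix ι J ℂ} (hQ : Qᴴ * Q = 1) :
    (complexNormal (0 : ι → ℂ) 1).map (fun x => x ᵥ* Q) = complexNormal 0 1 := by
  let w : J → EuclideanSpace ℂ ι := fun j => WithLp.toLp 2 fun i => star (Q i j)
  have hw : Orthonormal ℂ w := by
    rw [orthonormal_iff_ite]
    intro i j
    have h := congrFun (congrFun hQ j) i
    rw [Matrix.mul_apply, Matrix.one_apply] at h
    simp only [eq_comm (a := i), ← h, w, PiLp.inner_apply, RCLike.inner_apply, Matrix.conjTranspose_apply]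
    exact Finset.sum_congr rfl fun k _ => by simp
  have hcard : Fintype.card J ≤ Fintype.card ι := by
    have := hw.linearIndependent.fintype_card_le_finrank
    simpa using this
  -- complete the orthonormal family to a basis and project the rotated vector
  let J' := Fin (Fintype.card ι - Fintype.card J)
  let v : J ⊕ J' → EuclideanSpace ℂ ι := Sum.elim w 0
  have hv : Orthonormal ℂ ((Set.range Sum.inl).domRestrict v) := by
    rw [orthonormal_iff_ite] at hw ⊢
    rintro ⟨_, i, rfl⟩ ⟨_, j, rfl⟩
    convert! hw i j using 2
    exact Subtype.ext_iff.trans Sum.inl_injective.eq_iff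
  obtain ⟨b, hb⟩ := hv.exists_orthonormalBasis_extension_of_card_eq (by simp [J', hcard])
  let f : (ι → ℂ) ≃ₗ[ℝ] (J ⊕ J' → ℂ) :=
    ((WithLp.linearEquiv 2 ℂ (ι → ℂ)).symm ≪≫ₗ b.repr.toLinearEquiv ≪≫ₗ
      WithLp.linearEquiv 2 ℂ (J ⊕ J' → ℂ)).restrictScalars ℝ
  have hf : ∀ x j, f x j = b.repr (WithLp.toLp 2 x) j := fun _ _ => rfl
  have h1 : (complexNormal (0 : ι → ℂ) 1).map f = complexNormal 0 1 := by
    refine HasGibbsDensity.eq ?_ (hasGibbsDensity_complexNormal_one 0)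
    refine (hasGibbsDensity_complexNormal_one 0).map_linear inferInstance inferInstance f
      (by fun_prop) fun x => ?_
    have := congrArg (· ^ 2) (b.repr.norm_map (WithLp.toLp 2 x))
    simpa only [EuclideanSpace.norm_sq_eq, Pi.zero_apply, sub_zero, hf] using this
  have hfm : Measurable f := f.toContinuousLinearEquiv.continuous.measurable
  rw [← complexNormal_map_inl (α := J) (β := J'), ← h1,
    Measure.map_map (by fun_prop) hfm]
  congr 1
  ext x j
  simp only [Function.comp, hf, b.repr_apply_apply, hb _ ⟨j, rfl⟩, v, Sum.elim_inl, w,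
    PiLp.inner_apply, RCLike.inner_apply, Matrix.vecMul, dotProduct]
  exact Finset.sum_congr rfl fun k _ => by simp

omit [Fintype J] [DecidableEq ι] [DecidableEq J] in
lemma measurable_vecMul (Q : Matrix ι J ℂ) : Measurable fun x : ι → ℂ => x ᵥ* Q := by
  unfold Matrix.vecMul dotProduct
  fun_prop

omit [DecidableEq κ] in
lemma gaussianArray_map_vecMul {Q : Matrix ι J ℂ} (hQ : Qᴴ * Q = 1) :
    (gaussianArray κ ι).map (fun X k => X k ᵥ* Q) = gaussianArray κ J := by
  have h := complexNormal_map_vecMul hQ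
  have : IsProbabilityMeasure ((complexNormal (0 : ι → ℂ) 1).map (fun x => x ᵥ* Q)) := by
    rw [h]; infer_instance
  unfold gaussianArray
  rw [Measure.pi_map_pi fun _ => (measurable_vecMul Q).aemeasurable, h]

/-- Recombining the vectors of a Gaussian array along orthonormal coefficient vectors gives a
Gaussian array. -/
lemma gaussianArray_map_sum_mul {Q : Matrix ι J ℂ} (hQ : Qᴴ * Q = 1) :
    (gaussianArray ι κ).map (fun X j k => ∑ i, X i k * Q i j) = gaussianArray J κ := by
  rw [← gaussianArray_map_swap (ι := κ) (κ := J), ← gaussianArray_map_vecMul hQ,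
    ← gaussianArray_map_swap (ι := ι) (κ := κ)]
  have h1 : Measurable (fun (X : κ → ι → ℂ) k => X k ᵥ* Q) :=
    measurable_pi_lambda _ fun k => (measurable_vecMul Q).comp (measurable_pi_apply k)
  rw [Measure.map_map h1 (by fun_prop), Measure.map_map (by fun_prop) (by fun_prop)]
  rfl

omit [DecidableEq ι] in
lemma gaussianArray_map_option :
    (gaussianArray (Option ι) κ).map (fun X => (X none, fun i => X (some i))) =
      (complexNormal 0 1).prod (gaussianArray ι κ) := by
  have h := Measure.pi_map_piOptionEquivProd
    (fun _ : Option ι => complexNormal (0 : κ → ℂ) 1)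
  have h' := congrArg (fun ρ => Measure.map Prod.swap
    (Measure.map (MeasurableEquiv.piOptionEquivProd fun _ : Option ι => κ → ℂ) ρ)) h
  simp only [MeasurableEquiv.map_map_symm, Measure.prod_swap] at h'
  unfold gaussianArray
  rw [h', Measure.map_map (by fun_prop) (by fun_prop)]
  rfl

lemma gaussianArray_map_sum :
    (gaussianArray ι (α ⊕ β)).map
        (fun X => (fun i a => X i (Sum.inl a), fun i b => X i (Sum.inr b))) =
      (gaussianArray ι α).prod (gaussianArray ι β) := by
  have h := (measurePreserving_sumPiEquivProdPi
    (fun _ : α ⊕ β => complexNormal (0 : ι → ℂ) 1)).map_eq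
  have e1 : (gaussianArray α ι).map (fun X k i => X i k) = gaussianArray ι α :=
    gaussianArray_map_swap
  have e2 : (gaussianArray β ι).map (fun X k i => X i k) = gaussianArray ι β :=
    gaussianArray_map_swap
  rw [← e1, ← e2, Measure.map_prod_map _ _ (by fun_prop) (by fun_prop)]
  unfold gaussianArray at *
  rw [← h, ← gaussianArray, ← gaussianArray_map_swap, Measure.map_map (by fun_prop) (by fun_prop),
    Measure.map_map (by fun_prop) (by fun_prop), gaussianArray]
  rfl

end Symmetries

/-! ### Hermitian forms and orthonormal bases -/

section LinearAlgebra

variable {ι κ J : Type*} [Fintype ι] [Fintype κ] [Fintype J] [DecidableEq ι] [DecidableEq κ]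

omit [DecidableEq ι] [DecidableEq κ] in
lemma hermForm_conjTranspose_mul_mul (B : Matrix κ ι ℂ) (A : Matrix κ κ ℂ) (v : ι → ℂ) :
    hermForm (Bᴴ * A * B) v = hermForm A (B *ᵥ v) := by
  simp only [hermForm, Matrix.star_mulVec, ← Matrix.mulVec_mulVec, Matrix.dotProduct_mulVec,
    Matrix.vecMul_vecMul]

/-- Invariance of `v† A⁻¹ v` under a simultaneous change of basis. -/
lemma hermForm_inv_congr {T : Matrix ι ι ℂ} (hT : IsUnit T.det) (A : Matrix ι ι ℂ) (v : ι → ℂ) :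
    hermForm (T * A * Tᴴ)⁻¹ (T *ᵥ v) = hermForm A⁻¹ v := by
  rw [← hermForm_conjTranspose_mul_mul, Matrix.mul_inv_rev, Matrix.mul_inv_rev]
  have h : IsUnit Tᴴ.det := by rw [Matrix.det_conjTranspose]; exact hT.star
  congr 1
  rw [← mul_assoc, ← mul_assoc, Matrix.mul_nonsing_inv _ h, one_mul, mul_assoc,
    Matrix.nonsing_inv_mul _ hT, mul_one]

/-- If the rows of `Z` are linearly independent, then the orthogonal projection onto the kernel of
`Z` is `1 - Z† (Z Z†)⁻¹ Z`, and it is `Q Q†` for a matrix `Q` with orthonormal columns. -/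
lemma exists_kernel_basis (Z : Matrix ι κ ℂ) (hZ : IsUnit (Z * Zᴴ).det) :
    ∃ Q : Matrix κ (Fin (Fintype.card κ - Fintype.card ι)) ℂ,
      Qᴴ * Q = 1 ∧ Z * Q = 0 ∧ Q * Qᴴ = 1 - Zᴴ * (Z * Zᴴ)⁻¹ * Z := by
  let V := LinearMap.ker (Matrix.toEuclideanLin Z)
  have hker : ∀ y : EuclideanSpace ℂ κ, y ∈ V ↔ Z *ᵥ y.ofLp = 0 := by
    intro y
    simp only [V, LinearMap.mem_ker, Matrix.toLpLin_apply]
    exact (WithLp.toLp_injective 2).eq_iff' rfl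
  have hsurj : LinearMap.range (Matrix.toEuclideanLin Z) = ⊤ := by
    rw [LinearMap.range_eq_top]
    intro y
    refine ⟨WithLp.toLp 2 ((Zᴴ * (Z * Zᴴ)⁻¹) *ᵥ y.ofLp), ?_⟩
    rw [Matrix.toLpLin_apply]
    rw [Matrix.mulVec_mulVec, ← Matrix.mul_assoc, Matrix.mul_nonsing_inv _ hZ, Matrix.one_mulVec]
  have hdim : Module.finrank ℂ V = Fintype.card κ - Fintype.card ι := by
    have h : _ + Module.finrank ℂ V = _ :=
      LinearMap.finrank_range_add_finrank_ker (Matrix.toEuclideanLin Z)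
    rw [hsurj, finrank_top, finrank_euclideanSpace, finrank_euclideanSpace] at h
    omega
  let b := (stdOrthonormalBasis ℂ V).reindex (finCongr hdim)
  let Q : Matrix κ (Fin (Fintype.card κ - Fintype.card ι)) ℂ :=
    Matrix.of fun k j => (b j : EuclideanSpace ℂ κ) k
  have hQQ : Qᴴ * Q = 1 := by
    ext i j
    have h := orthonormal_iff_ite.mp b.orthonormal i j
    rw [Matrix.mul_apply, Matrix.one_apply, ← h]
    simp only [Submodule.coe_inner, PiLp.inner_apply, RCLike.inner_apply]
    exact Finset.sum_congr rfl fun k _ => by simp [Q, mul_comm]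
  have hZQ : Z * Q = 0 := by
    ext i j
    exact congrFun ((hker _).mp (b j).2) i
  have hproj : ∀ y, Z *ᵥ y = 0 → (Q * Qᴴ) *ᵥ y = y := by
    intro y hy
    have h := b.sum_repr' ⟨WithLp.toLp 2 y, (hker _).mpr hy⟩
    ext k
    have h2 := congrArg (fun z : V => (z : EuclideanSpace ℂ κ) k) h
    simp only [Submodule.coe_sum, Submodule.coe_smul, Submodule.coe_inner] at h2
    rw [← Matrix.mulVec_mulVec, Matrix.mulVec, dotProduct]
    refine Eq.trans ?_ h2
    rw [WithLp.ofLp_sum, Finset.sum_apply]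
    refine Finset.sum_congr rfl fun j _ => ?_
    simp only [PiLp.smul_apply, smul_eq_mul, PiLp.inner_apply, RCLike.inner_apply, Matrix.mulVec,
      dotProduct, Matrix.conjTranspose_apply, Q, Matrix.of_apply]
    rw [mul_comm]
    congr 1
    exact Finset.sum_congr rfl fun l _ => by simp [mul_comm]
  refine ⟨Q, hQQ, hZQ, ?_⟩
  set P := 1 - Zᴴ * (Z * Zᴴ)⁻¹ * Z with hP
  have hZP : Z * P = 0 := by
    rw [hP, Matrix.mul_sub, Matrix.mul_one, ← Matrix.mul_assoc, ← Matrix.mul_assoc, Matrix.mul_nonsing_inv _ hZ,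
      Matrix.one_mul, sub_self]
  have h1 : Q * Qᴴ * P = P := by
    ext k l
    exact congrFun (hproj (fun k => P k l) (funext fun i => congrFun (congrFun hZP i) l)) k
  have h2 : Qᴴ * Zᴴ = 0 := by rw [← Matrix.conjTranspose_mul, hZQ, Matrix.conjTranspose_zero]
  rw [← h1, hP, mul_sub, mul_one, Matrix.mul_assoc Q, ← Matrix.mul_assoc Qᴴ, ← Matrix.mul_assoc Qᴴ,
    h2]
  simp

omit [DecidableEq κ] in
/-- Every vector is a multiple of the first vector of some orthonormal basis. -/
lemma exists_unitary_vecMul (y : ι → ℂ) (i₀ : ι) : ∃ Q : Matrix ι ι ℂ, Qᴴ * Q = 1 ∧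
    y ᵥ* Q = Pi.single i₀ (√(∑ i, ‖y i‖ ^ 2) : ℂ) := by
  rcases eq_or_ne y 0 with rfl | hy
  · exact ⟨1, by simp, by simp⟩
  set z : EuclideanSpace ℂ ι := WithLp.toLp 2 y
  have hz : z ≠ 0 := fun h => hy (congrArg WithLp.ofLp h)
  have hz' : ‖z‖ ≠ 0 := norm_ne_zero_iff.mpr hz
  let v : ι → EuclideanSpace ℂ ι := fun _ => (‖z‖⁻¹ : ℂ) • z
  have hv : Orthonormal ℂ (({i₀} : Set ι).domRestrict v) := by
    refine ⟨fun i => ?_, fun i j hij => absurd (Subsingleton.elim i j) hij⟩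
    simp [v, Set.domRestrict, norm_smul, hz']
  obtain ⟨b, hb⟩ := hv.exists_orthonormalBasis_extension_of_card_eq (by simp)
  refine ⟨Matrix.of fun i j => star (b j i), ?_, ?_⟩
  · ext i j
    have h := orthonormal_iff_ite.mp b.orthonormal j i
    rw [Matrix.mul_apply, Matrix.one_apply]
    simp only [eq_comm (a := i), ← h, PiLp.inner_apply, RCLike.inner_apply,
      Matrix.conjTranspose_apply, Matrix.of_apply, star_star]
    exact Finset.sum_congr rfl fun k _ => by simp
  · have hin : ∀ j, (y ᵥ* Matrix.of fun i j => star (b j i)) j = inner ℂ (b j) z := by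
      intro j
      simp only [Matrix.vecMul, dotProduct, PiLp.inner_apply, RCLike.inner_apply, Matrix.of_apply]
      exact Finset.sum_congr rfl fun k _ => by simp [z]
    have hz2 : z = (‖z‖ : ℂ) • b i₀ := by
      rw [hb i₀ rfl, smul_smul, mul_inv_cancel₀ (by exact_mod_cast hz'), one_smul]
    have hn : √(∑ i, ‖y i‖ ^ 2) = ‖z‖ := (EuclideanSpace.norm_eq z).symm
    ext j
    rw [hin, hn]
    conv_lhs => rw [hz2]
    rw [inner_smul_right, orthonormal_iff_ite.mp b.orthonormal j i₀, Pi.single_apply]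
    simp

/-- The upper left entry of `(W W†)⁻¹` is the inverse squared length of the component of the first
row of `W` that is orthogonal to the other rows. -/
lemma hermForm_inv_single_zero {d : ℕ} (w : κ → ℂ) (Z : Matrix (Fin d) κ ℂ) {Q : Matrix κ J ℂ}
    (hZQ : Z * Q = 0) (hQ : Q * Qᴴ = 1 - Zᴴ * (Z * Zᴴ)⁻¹ * Z) {W : Matrix (Fin (d + 1)) κ ℂ}
    (h0 : W 0 = w) (hsucc : ∀ i, W (Fin.succ i) = Z i) (hW : IsUnit (W * Wᴴ).det) (c : ℝ) :
    hermForm (W * Wᴴ)⁻¹ (Pi.single 0 (c : ℂ)) = c ^ 2 / ∑ j, ‖(w ᵥ* Q) j‖ ^ 2 := by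
  -- `x ᵥ* W` is the first row minus its projection onto the span of the others
  set x : Fin (d + 1) → ℂ := Fin.cons 1 (-(w ᵥ* (Zᴴ * (Z * Zᴴ)⁻¹))) with hx
  have hxW : x ᵥ* W = w ᵥ* (Q * Qᴴ) := by
    rw [hQ, Matrix.vecMul_sub, Matrix.vecMul_one,
      ← Matrix.vecMul_vecMul w (Zᴴ * (Z * Zᴴ)⁻¹)]
    ext k
    generalize w ᵥ* (Zᴴ * (Z * Zᴴ)⁻¹) = u at hx
    simp [Matrix.vecMul, dotProduct, Fin.sum_univ_succ, hx, h0, hsucc, sub_eq_add_neg]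
  set p : ℂ := ((∑ j, ‖(w ᵥ* Q) j‖ ^ 2 : ℝ) : ℂ) with hp
  have hxG : x ᵥ* (W * Wᴴ) = Pi.single 0 p := by
    rw [← Matrix.vecMul_vecMul, hxW]
    ext i
    refine Fin.cases ?_ (fun i => ?_) i
    · rw [Pi.single_eq_same]
      have h1 : (w ᵥ* (Q * Qᴴ) ᵥ* Wᴴ) 0 = (w ᵥ* Q) ⬝ᵥ star (w ᵥ* Q) := by
        rw [Matrix.star_vecMul, Matrix.dotProduct_mulVec, Matrix.vecMul_vecMul w Q Qᴴ]
        generalize w ᵥ* (Q * Qᴴ) = u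
        simp only [Matrix.vecMul, dotProduct, Matrix.conjTranspose_apply, h0, Pi.star_apply]
      rw [h1, hp, dotProduct, Complex.ofReal_sum]
      refine Finset.sum_congr rfl fun j _ => ?_
      rw [Pi.star_apply, Complex.star_def, Complex.mul_conj, Complex.normSq_eq_norm_sq]
    · rw [Pi.single_eq_of_ne (Fin.succ_ne_zero i)]
      have h1 : (w ᵥ* (Q * Qᴴ) ᵥ* Wᴴ) i.succ = (w ᵥ* (Q * Qᴴ) ᵥ* Zᴴ) i := by
        simp only [Matrix.vecMul, dotProduct, Matrix.conjTranspose_apply, hsucc]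
      rw [h1, Matrix.vecMul_vecMul, Matrix.mul_assoc, ← Matrix.conjTranspose_mul, hZQ]
      simp
  have hinv : x = Pi.single 0 p ᵥ* (W * Wᴴ)⁻¹ := by
    rw [← hxG, Matrix.vecMul_vecMul, Matrix.mul_nonsing_inv _ hW, Matrix.vecMul_one]
  have h00 : 1 = p * (W * Wᴴ)⁻¹ 0 0 := by
    have := congrFun hinv 0
    rwa [Matrix.single_vecMul, hx, Fin.cons_zero] at this
  have hval : (W * Wᴴ)⁻¹ 0 0 = p⁻¹ := by
    have hp0 : p ≠ 0 := fun h => by simp [h] at h00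
    rw [eq_comm, inv_eq_of_mul_eq_one_right h00.symm]
  have h2 : (star (Pi.single 0 (c : ℂ)) ⬝ᵥ (W * Wᴴ)⁻¹ *ᵥ Pi.single 0 (c : ℂ) : ℂ)
      = c * (p⁻¹ * c) := by
    rw [Pi.star_single, single_dotProduct, Matrix.mulVec_single]
    simp [hval]
  rw [hermForm, h2, hp]
  norm_cast
  ring

end LinearAlgebra

section Nonsingular

variable {κ : Type*} [Fintype κ] [DecidableEq κ]

/-- At most `|κ|` independent vectors with absolutely continuous laws are almost surely linearly
independent: each avoids the span of the previous ones. -/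
lemma ae_linearIndependent (s : ℕ) (hs : s ≤ Fintype.card κ) :
    ∀ᵐ Y ∂gaussianArray (Fin s) κ, LinearIndependent ℂ Y := by
  induction s with
  | zero => exact .of_forall fun Y => linearIndependent_empty_type
  | succ s ih =>
    have ih := ih (by omega)
    unfold gaussianArray at *
    have hmp := measurePreserving_piFinSuccAbove
      (fun _ : Fin (s + 1) => complexNormal (0 : κ → ℂ) 1) 0
    have key : ∀ᵐ p ∂(complexNormal (0 : κ → ℂ) 1).prod
        (Measure.pi fun _ : Fin s => complexNormal (0 : κ → ℂ) 1),
        LinearIndependent ℂ (Fin.cons p.1 p.2 : Fin (s + 1) → κ → ℂ) := by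
      have hmeas : MeasurableSet {p : (κ → ℂ) × (Fin s → κ → ℂ) |
          LinearIndependent ℂ (Fin.cons p.1 p.2 : Fin (s + 1) → κ → ℂ)} :=
        (isOpen_setOfPred_linearIndependent.preimage (by fun_prop)).measurableSet
      refine (Measure.ae_prod_iff_ae_ae hmeas).mpr ?_
      rw [Measure.ae_ae_comm hmeas]
      filter_upwards [ih] with Y hY
      have hspan : (Submodule.span ℂ (Set.range Y)).restrictScalars ℝ ≠ ⊤ := by
        intro h
        rw [Submodule.restrictScalars_eq_top_iff] at h
        have := finrank_range_le_card (R := ℂ) (b := Y)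
        rw [Set.finrank, h, finrank_top, Module.finrank_fintype_fun_eq_card, Fintype.card_fin] at this
        omega
      have h0 : (complexNormal (0 : κ → ℂ) 1) (Submodule.span ℂ (Set.range Y) : Set (κ → ℂ)) = 0 :=
        withDensity_absolutelyContinuous _ _
          (Measure.addHaar_submodule volume _ hspan)
      filter_upwards [measure_eq_zero_iff_ae_notMem.mp h0] with v hv
      exact linearIndependent_finCons.mpr ⟨hY, hv⟩
    have := hmp.quasiMeasurePreserving.ae key
    filter_upwards [this] with Y hY
    convert hY
    exact (Fin.cons_self_tail Y).symm

omit [DecidableEq κ] in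
lemma isUnit_det_mul_conjTranspose {ι : Type*} [Fintype ι] [DecidableEq ι] {Z : Matrix ι κ ℂ}
    (hZ : LinearIndependent ℂ Z) : IsUnit (Z * Zᴴ).det :=
  (Matrix.isUnit_iff_isUnit_det _).mp
    (Matrix.PosDef.mul_conjTranspose_self Z (Matrix.vecMul_injective_iff.mpr hZ)).isUnit

end Nonsingular

/-! ### The complex chi-square law as a Poisson mixture of Gamma laws -/

section ChiSquare

lemma integrableOn_pow_mul_cexp {b : ℂ} (hb : 0 < b.re) (k : ℕ) :
    IntegrableOn (fun x : ℝ => (x : ℂ) ^ k * Complex.exp (-b * x)) (Set.Ioi 0) := by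
  have h := integrableOn_rpow_mul_exp_neg_mul_rpow (p := 1) (s := k) (b := b.re)
    (by have := k.cast_nonneg (α := ℝ); linarith) one_pos hb
  refine Integrable.mono' h (by fun_prop) ?_
  refine ae_restrict_of_forall_mem measurableSet_Ioi fun x hx => le_of_eq ?_
  have hx : (0 : ℝ) < x := hx
  rw [norm_mul, norm_pow, Complex.norm_exp, Complex.norm_real, Real.norm_of_nonneg hx.le]
  simp

/-- The Gamma integral at a complex rate. -/
lemma integral_pow_mul_cexp {b : ℂ} (hb : 0 < b.re) (k : ℕ) :
    ∫ x : ℝ in Set.Ioi 0, (x : ℂ) ^ k * Complex.exp (-b * x) = k ! / b ^ (k + 1) := by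
  have hb0 : b ≠ 0 := fun h => by simp [h] at hb
  induction k with
  | zero =>
    have := integral_exp_mul_complex_Ioi (a := -b) (by simpa using hb) 0
    simpa [neg_div] using this
  | succ k ih =>
    have hderiv : ∀ x ∈ Set.Ici (0 : ℝ), HasDerivAt
        (fun x : ℝ => -((x : ℂ) ^ (k + 1) * Complex.exp (-b * x)) / b)
        ((x : ℂ) ^ (k + 1) * Complex.exp (-b * x)
          - ((k + 1) / b) * ((x : ℂ) ^ k * Complex.exp (-b * x))) x := by
      intro x _
      have h1 : HasDerivAt (fun x : ℝ => (x : ℂ)) 1 x := Complex.ofRealCLM.hasDerivAt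
      have h2 := (((h1.pow (k + 1)).mul ((h1.const_mul (-b)).cexp)).neg).div_const b
      refine h2.congr_deriv ?_
      simp
      field_simp
      ring
    have hint : IntegrableOn (fun x : ℝ => (x : ℂ) ^ (k + 1) * Complex.exp (-b * x)
          - ((k + 1) / b) * ((x : ℂ) ^ k * Complex.exp (-b * x))) (Set.Ioi 0) :=
      (integrableOn_pow_mul_cexp hb (k + 1)).sub ((integrableOn_pow_mul_cexp hb k).const_mul _)
    have hlim : Filter.Tendsto (fun x : ℝ => -((x : ℂ) ^ (k + 1) * Complex.exp (-b * x)) / b)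
        Filter.atTop (nhds 0) := by
      rw [tendsto_zero_iff_norm_tendsto_zero]
      have h := (tendsto_rpow_mul_exp_neg_mul_atTop_nhds_zero (k + 1 : ℕ) b.re hb).div_const ‖b‖
      rw [zero_div] at h
      simp_rw [Real.rpow_natCast] at h
      refine h.congr' ?_
      filter_upwards [Filter.eventually_gt_atTop 0] with x hx
      rw [norm_div, norm_neg, norm_mul, norm_pow, Complex.norm_exp, Complex.norm_real,
        Real.norm_of_nonneg hx.le]
      simp
    have h := integral_Ioi_of_hasDerivAt_of_tendsto' hderiv hint hlim
    rw [integral_sub (integrableOn_pow_mul_cexp hb (k + 1))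
      ((integrableOn_pow_mul_cexp hb k).const_mul _), integral_const_mul, ih] at h
    simp only [Complex.ofReal_zero, ne_eq, Nat.succ_ne_zero, not_false_eq_true, zero_pow, zero_mul,
      neg_zero, zero_div, sub_zero] at h
    rw [sub_eq_zero.mp h, Nat.factorial_succ]
    push_cast
    field_simp
    ring

lemma gammaMeasure_eq_natCast (k : ℕ) : gammaMeasure (k + 1 : ℕ) 1 =
    (volume.restrict (Set.Ioi 0)).withDensity
      fun x => ENNReal.ofReal ((k ! : ℝ)⁻¹ * x ^ k * Real.exp (-x)) := by
  rw [gammaMeasure, ← withDensity_indicator measurableSet_Ioi]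
  refine withDensity_congr_ae ?_
  filter_upwards [Measure.ae_ne volume 0] with x hx
  by_cases h : 0 < x
  · rw [Set.indicator_of_mem (Set.mem_Ioi.mpr h), gammaPDF_of_nonneg h.le]
    push_cast
    rw [Real.Gamma_nat_eq_factorial]
    simp
  · rw [Set.indicator_of_notMem (by simpa using h),
      gammaPDF_of_neg (lt_of_le_of_ne (not_lt.mp h) hx)]

lemma charFun_gammaMeasure (k : ℕ) (t : ℝ) :
    charFun (gammaMeasure (k + 1 : ℕ) 1) t = 1 / (1 - t * Complex.I) ^ (k + 1) := by
  rw [charFun_apply_real, gammaMeasure_eq_natCast, integral_withDensity_eq_integral_toReal_smul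
    (by fun_prop) (.of_forall fun _ => ENNReal.ofReal_lt_top)]
  have hb : 0 < (1 - t * Complex.I : ℂ).re := by simp
  have h := integral_pow_mul_cexp hb k
  have hk : (k ! : ℂ) ≠ 0 := by exact_mod_cast k.factorial_ne_zero
  rw [show 1 / (1 - t * Complex.I) ^ (k + 1)
    = (k ! : ℂ)⁻¹ * (k ! / (1 - t * Complex.I) ^ (k + 1)) by field_simp, ← h, ← integral_const_mul]
  refine setIntegral_congr_fun measurableSet_Ioi fun x hx => ?_
  have hx : (0 : ℝ) < x := hx
  rw [ENNReal.toReal_ofReal (by positivity), Complex.real_smul]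
  push_cast
  rw [mul_assoc, mul_assoc, ← Complex.exp_add, mul_assoc]
  congr 3
  ring_nf

/-- The noncentral chi-square distribution as a Poisson mixture of Gamma distributions; the mixing
parameter is the noncentrality. -/
noncomputable def poissonGamma (n : ℕ) (l : ℝ) : Measure ℝ :=
  Measure.sum fun j : ℕ =>
    ENNReal.ofReal (Real.exp (-l) * l ^ j / j !) • gammaMeasure (n + j : ℕ) 1

lemma hasSum_exp_neg_mul (l : ℝ) : HasSum (fun j : ℕ => Real.exp (-l) * l ^ j / j !) 1 := by
  have h := (NormedSpace.expSeries_div_hasSum_exp l).mul_left (Real.exp (-l))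
  rw [← Real.exp_eq_exp_ℝ, ← Real.exp_add, neg_add_cancel, Real.exp_zero] at h
  simpa only [mul_div_assoc] using h

lemma isProbabilityMeasure_gammaMeasure_nat {n : ℕ} (hn : 1 ≤ n) (j : ℕ) :
    IsProbabilityMeasure (gammaMeasure (n + j : ℕ) 1) :=
  isProbabilityMeasure_gammaMeasure (by exact_mod_cast (by omega : 0 < n + j)) one_pos

lemma isProbabilityMeasure_poissonGamma {n : ℕ} (hn : 1 ≤ n) {l : ℝ} (hl : 0 ≤ l) :
    IsProbabilityMeasure (poissonGamma n l) := by
  have := isProbabilityMeasure_gammaMeasure_nat hn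
  have h := hasSum_exp_neg_mul l
  refine ⟨?_⟩
  rw [poissonGamma, Measure.sum_apply _ MeasurableSet.univ]
  simp only [Measure.smul_apply, measure_univ, smul_eq_mul, mul_one]
  rw [← ENNReal.ofReal_tsum_of_nonneg (fun j => by positivity) h.summable, h.tsum_eq,
    ENNReal.ofReal_one]

lemma charFun_poissonGamma {n : ℕ} (hn : 1 ≤ n) {l : ℝ} (hl : 0 ≤ l) (t : ℝ) :
    charFun (poissonGamma n l) t =
      1 / (1 - t * Complex.I) ^ n * Complex.exp (l * (1 / (1 - t * Complex.I) - 1)) := by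
  have hp := isProbabilityMeasure_poissonGamma hn hl
  rw [charFun_apply_real]
  have hint : Integrable (fun x : ℝ => Complex.exp (t * x * Complex.I)) (poissonGamma n l) := by
    refine Integrable.of_bound (by fun_prop) 1 (.of_forall fun x => le_of_eq ?_)
    rw [← Complex.ofReal_mul, Complex.norm_exp_ofReal_mul_I]
  have h := hasSum_integral_measure hint
  refine h.unique ?_
  set b : ℂ := 1 - t * Complex.I with hb
  have he : HasSum (fun j : ℕ => (l / b : ℂ) ^ j / j !) (Complex.exp (l / b)) := by
    rw [Complex.exp_eq_exp_ℂ]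
    exact NormedSpace.expSeries_div_hasSum_exp _
  have h2 : HasSum (fun j : ℕ => 1 / b ^ n * Complex.exp (-l) * ((l / b) ^ j / j !))
      (1 / b ^ n * Complex.exp (-l) * Complex.exp (l / b)) :=
    he.mul_left _
  rw [mul_assoc, ← Complex.exp_add] at h2
  convert! h2 using 1
  · ext j
    rw [integral_smul_measure, ← charFun_apply_real]
    obtain ⟨m, rfl⟩ : ∃ m, n = m + 1 := ⟨n - 1, by omega⟩
    rw [show m + 1 + j = m + j + 1 by ring, charFun_gammaMeasure,
      ENNReal.toReal_ofReal (by positivity), Complex.real_smul, ← hb, div_pow]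
    clear_value b
    push_cast
    ring
  · congr 2
    ring

/-- The characteristic function of `|x|²` for `x ∼ CN(a, 1)`. -/
lemma charFun_stdComplexNormal_normSq (a : ℂ) (t : ℝ) :
    ∫ x : ℂ, Complex.exp (t * (‖x‖ ^ 2 : ℝ) * Complex.I) ∂stdComplexNormal a =
      1 / (1 - t * Complex.I) *
        Complex.exp ((‖a‖ ^ 2 : ℝ) * (1 / (1 - t * Complex.I) - 1)) := by
  set b : ℂ := 1 - t * Complex.I with hb
  have hbre : 0 < b.re := by simp [hb]
  have hb0 : b ≠ 0 := fun h => by simp [h] at hbre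
  have h := GaussianFourier.integral_cexp_neg_mul_sq_norm_add (V := ℂ) hbre 2 a
  rw [Complex.finrank_real_complex] at h
  rw [stdComplexNormal, integral_withDensity_eq_integral_toReal_smul
    (by fun_prop) (.of_forall fun _ => ENNReal.ofReal_lt_top)]
  have h2 : ∀ x : ℂ, (ENNReal.ofReal (Real.pi⁻¹ * Real.exp (-‖x - a‖ ^ 2))).toReal •
      Complex.exp (t * (‖x‖ ^ 2 : ℝ) * Complex.I) =
      ((Real.pi : ℂ)⁻¹ * Complex.exp (-(‖a‖ ^ 2 : ℝ))) *
        Complex.exp (-b * (‖x‖ : ℂ) ^ 2 + 2 * (inner ℝ a x : ℝ)) := by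
    intro x
    rw [ENNReal.toReal_ofReal (by positivity), Complex.real_smul, norm_sub_sq_real,
      real_inner_comm]
    push_cast
    rw [mul_assoc, mul_assoc _ (Complex.exp _) (Complex.exp _), ← Complex.exp_add,
      ← Complex.exp_add]
    congr 2
    rw [hb]
    ring
  simp_rw [h2]
  rw [integral_const_mul, h]
  have hpi : (Real.pi : ℂ) ≠ 0 := by exact_mod_cast Real.pi_ne_zero
  rw [show (((2 : ℕ) : ℂ) / 2) = 1 by norm_num, Complex.cpow_one,
    show ∀ p e d f : ℂ, p * e * (d * f) = p * d * (e * f) by intros; ring, ← Complex.exp_add]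
  congr 1
  · field_simp
  · congr 1
    push_cast
    field_simp
    ring

/-- The squared length of a complex normal vector with mean `μ` and identity covariance has a law
depending on `μ` only through its length. -/
lemma complexNormal_map_normSq {ι : Type*} [Fintype ι] [DecidableEq ι] [Nonempty ι] (μ : ι → ℂ) :
    (complexNormal μ 1).map (fun x => ∑ i, ‖x i‖ ^ 2) =
      poissonGamma (Fintype.card ι) (∑ i, ‖μ i‖ ^ 2) := by
  have hm : Measurable fun x : ι → ℂ => ∑ i, ‖x i‖ ^ 2 := by fun_prop
  have h1 := isProbabilityMeasure_poissonGamma (n := Fintype.card ι) Fintype.card_pos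
    (l := ∑ i, ‖μ i‖ ^ 2) (by positivity)
  have h2 : IsProbabilityMeasure ((complexNormal μ 1).map fun x => ∑ i, ‖x i‖ ^ 2) :=
    Measure.isProbabilityMeasure_map hm.aemeasurable
  refine Measure.ext_of_charFun (funext fun t => ?_)
  rw [charFun_poissonGamma Fintype.card_pos (by positivity), charFun_apply_real,
    integral_map hm.aemeasurable (by fun_prop), complexNormal_one_eq_pi]
  have h3 : ∀ x : ι → ℂ, Complex.exp (t * ((∑ i, ‖x i‖ ^ 2 : ℝ) : ℂ) * Complex.I) =
      ∏ i, Complex.exp (t * (‖x i‖ ^ 2 : ℝ) * Complex.I) := by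
    intro x
    rw [← Complex.exp_sum, Complex.ofReal_sum, Finset.mul_sum, Finset.sum_mul]
  simp_rw [h3]
  rw [integral_fintype_prod_eq_prod (f := fun _ x => Complex.exp (t * (‖x‖ ^ 2 : ℝ) * Complex.I))]
  simp_rw [charFun_stdComplexNormal_normSq]
  rw [Finset.prod_mul_distrib, Finset.prod_const, ← Complex.exp_sum, Finset.card_univ, one_div_pow,
    Complex.ofReal_sum, Finset.sum_mul]

lemma complexChiSq_eq {n : ℕ} (hn : 1 ≤ n) (δ : ℝ) :
    complexChiSq n δ = poissonGamma n (δ ^ 2) := by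
  obtain ⟨n, rfl⟩ : ∃ m, n = m + 1 := ⟨n - 1, by omega⟩
  rw [complexChiSq, complexNormal_map_normSq, Fintype.card_fin]
  congr 1
  rw [Fin.sum_univ_succ]
  simp

end ChiSquare

/-! ### Densities of the complex Beta laws -/

section Beta

lemma lintegral_pow_mul_exp_neg (k : ℕ) {r : ℝ} (hr : 0 < r) :
    ∫⁻ x in Set.Ioi 0, ENNReal.ofReal (x ^ k * Real.exp (-(r * x))) =
      ENNReal.ofReal (k ! / r ^ (k + 1)) := by
  have h := Real.integral_rpow_mul_exp_neg_mul_Ioi (a := k + 1) (by positivity) hr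
  have hpos : (0 : ℝ) < (1 / r) ^ ((k : ℝ) + 1) * Real.Gamma (k + 1) := by positivity
  have hint : IntegrableOn (fun x : ℝ => x ^ ((k : ℝ) + 1 - 1) * Real.exp (-(r * x)))
      (Set.Ioi 0) := by
    by_contra hc
    rw [integral_undef hc] at h
    exact hpos.ne h
  simp only [add_sub_cancel_right, Real.rpow_natCast] at h hint
  rw [← ofReal_integral_eq_lintegral_ofReal hint
    (ae_restrict_of_forall_mem measurableSet_Ioi fun x hx => by
      have hx : (0 : ℝ) < x := hx
      positivity), h, Real.Gamma_nat_eq_factorial]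
  norm_cast
  congr 1
  rw [one_div, inv_pow]
  field_simp

/-- The change of variables `a ↦ 1 / (1 + a / b)`, from `(0, ∞)` to `(0, 1)`. -/
lemma lintegral_Ioi_eq_lintegral_Ioo {b : ℝ} (hb : 0 < b) (g : ℝ → ENNReal) :
    ∫⁻ a in Set.Ioi 0, g a =
      ∫⁻ x in Set.Ioo 0 1, ENNReal.ofReal (b / x ^ 2) * g (b * (x⁻¹ - 1)) := by
  have himg : (fun x : ℝ => b * (x⁻¹ - 1)) '' Set.Ioo 0 1 = Set.Ioi 0 := by
    ext a
    constructor
    · rintro ⟨x, ⟨h0, h1⟩, rfl⟩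
      have := (one_lt_inv₀ h0).mpr h1
      exact mul_pos hb (by linarith)
    · intro ha
      have ha : 0 < a := ha
      refine ⟨(1 + a / b)⁻¹, ⟨by positivity, inv_lt_one_of_one_lt₀ ?_⟩, ?_⟩
      · have : 0 < a / b := by positivity
        linarith
      · simp only [inv_inv]
        field_simp
        ring
  rw [← himg, lintegral_image_eq_lintegral_abs_deriv_mul (f' := fun x => b * (-(x ^ 2)⁻¹))
    measurableSet_Ioo]
  · refine setLIntegral_congr_fun measurableSet_Ioo fun x hx => ?_
    have := hx.1
    rw [mul_neg, abs_neg, abs_of_pos (by positivity), div_eq_mul_inv]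
  · intro x hx
    exact (((hasDerivAt_inv hx.1.ne').sub_const 1).const_mul b).hasDerivWithinAt
  · intro x hx y hy h
    have := mul_left_cancel₀ hb.ne' h
    exact inv_injective (by linarith)

/-- If `a` and `b` are independent Gamma variables with integer shapes, then `1 / (1 + a / b)` has a
Beta distribution. -/
lemma gammaMeasure_prod_map (p q : ℕ) :
    ((gammaMeasure (p + 1 : ℕ) 1).prod (gammaMeasure (q + 1 : ℕ) 1)).map
        (fun v => 1 / (1 + v.1 / v.2)) =
      volume.withDensity ((Set.Ioc 0 1).indicator
        fun x => ENNReal.ofReal (complexBetaPdf (q + 1) (p + 1) x)) := by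
  have hm : Measurable fun v : ℝ × ℝ => 1 / (1 + v.1 / v.2) := by fun_prop
  have hpdf : Measurable fun x : ℝ => ENNReal.ofReal (complexBetaPdf (q + 1) (p + 1) x) := by
    unfold complexBetaPdf; fun_prop
  have : SFinite (gammaMeasure (p + 1 : ℕ) 1) := by unfold gammaMeasure; infer_instance
  have : SFinite (gammaMeasure (q + 1 : ℕ) 1) := by unfold gammaMeasure; infer_instance
  refine Measure.ext_of_lintegral _ fun g hg => ?_
  rw [lintegral_map hg hm, lintegral_prod_symm (fun v : ℝ × ℝ => g (1 / (1 + v.1 / v.2)))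
      (by fun_prop), withDensity_indicator
    measurableSet_Ioc, restrict_Ioo_eq_restrict_Ioc.symm, lintegral_withDensity_eq_lintegral_mul _ hpdf hg,
    gammaMeasure_eq_natCast, gammaMeasure_eq_natCast]
  rw [lintegral_withDensity_eq_lintegral_mul _ (by fun_prop)
    (by exact Measurable.lintegral_prod_left' (hg.comp hm))]
  set K : ℝ → ℝ → ℝ := fun b x => (q ! : ℝ)⁻¹ * (p ! : ℝ)⁻¹ * x⁻¹ ^ 2 * (x⁻¹ - 1) ^ p *
    (b ^ (p + q + 1) * Real.exp (-(x⁻¹ * b))) with hK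
  have hKm : Measurable (Function.uncurry K) := by
    simp only [hK, Function.uncurry_def]; fun_prop
  calc _ = ∫⁻ b in Set.Ioi 0, ∫⁻ x in Set.Ioo 0 1, ENNReal.ofReal (K b x) * g x := by
        refine setLIntegral_congr_fun measurableSet_Ioi fun b hb => ?_
        have hb : 0 < b := hb
        simp only [Pi.mul_apply]
        rw [lintegral_withDensity_eq_lintegral_mul _ (by fun_prop) (by fun_prop),
          lintegral_Ioi_eq_lintegral_Ioo hb, ← lintegral_const_mul _ (by fun_prop)]
        refine setLIntegral_congr_fun measurableSet_Ioo fun x hx => ?_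
        have hx0 := hx.1
        have h1 : 0 < x⁻¹ - 1 := by linarith [(one_lt_inv₀ hx0).mpr hx.2]
        simp only [Pi.mul_apply]
        have hgx : 1 / (1 + b * (x⁻¹ - 1) / b) = x := by
          rw [mul_div_assoc, mul_div_cancel₀ _ hb.ne']
          simp
        rw [hgx, ← mul_assoc, ← mul_assoc, ← ENNReal.ofReal_mul (by positivity),
          ← ENNReal.ofReal_mul (by positivity)]
        congr 2
        have hexp : Real.exp (-(x⁻¹ * b)) = Real.exp (-b) * Real.exp (-(b * (x⁻¹ - 1))) := by
          rw [← Real.exp_add]; ring_nf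
        simp only [hK]
        rw [hexp, mul_pow, div_eq_mul_inv, inv_pow]
        ring
    _ = ∫⁻ x in Set.Ioo 0 1, ∫⁻ b in Set.Ioi 0, ENNReal.ofReal (K b x) * g x :=
        lintegral_lintegral_swap
          ((hKm.ennreal_ofReal.mul (hg.comp measurable_snd)).aemeasurable)
    _ = _ := by
        refine setLIntegral_congr_fun measurableSet_Ioo fun x hx => ?_
        have hx0 := hx.1
        have h1 : 0 < x⁻¹ - 1 := by linarith [(one_lt_inv₀ hx0).mpr hx.2]
        simp only [Pi.mul_apply]
        rw [lintegral_mul_const _ (by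
          exact (hKm.comp (measurable_id.prodMk measurable_const)).ennreal_ofReal)]
        congr 1
        simp only [hK]
        simp_rw [ENNReal.ofReal_mul (p := (q ! : ℝ)⁻¹ * (p ! : ℝ)⁻¹ * x⁻¹ ^ 2 * (x⁻¹ - 1) ^ p)
          (by positivity)]
        rw [lintegral_const_mul _ (by fun_prop), lintegral_pow_mul_exp_neg _ (inv_pos.mpr hx0),
          ← ENNReal.ofReal_mul (by positivity)]
        congr 1
        have h2 : x⁻¹ - 1 = (1 - x) / x := by field_simp
        simp only [complexBetaPdf, Nat.add_sub_cancel, h2]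
        rw [show q + 1 + (p + 1) - 1 = p + q + 1 by omega, div_pow, inv_pow, inv_pow]
        field_simp
        ring

/-- Vandermonde's identity, in the form needed to rearrange the Poisson mixture of Beta densities
into an exponential times a polynomial. -/
lemma sum_choose_mul_descFactorial (n p j : ℕ) :
    ∑ k ∈ Finset.range (n + 1),
      (n.choose k : ℝ) * ((n + p)! / (p + k)!) * j.descFactorial k = (n + p + j)! / (p + j)! := by
  have hv := Nat.add_choose_eq j (n + p) n
  rw [Finset.Nat.sum_antidiagonal_eq_sum_range_succ_mk] at hv
  have h1 : ((n + p + j)! : ℝ) / (p + j)! = n ! * ((j + (n + p)).choose n : ℕ) := by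
    rw [Nat.cast_choose ℝ (by omega : n ≤ j + (n + p)), show j + (n + p) - n = p + j by omega,
      show j + (n + p) = n + p + j by omega]
    field_simp
  rw [h1, hv, Nat.cast_sum, Finset.mul_sum]
  refine Finset.sum_congr rfl fun k hk => ?_
  have hk : k ≤ n := Nat.lt_succ_iff.mp (Finset.mem_range.mp hk)
  rw [Nat.descFactorial_eq_factorial_mul_choose, Nat.cast_mul, Nat.cast_mul,
    Nat.cast_choose ℝ hk, Nat.cast_choose ℝ (by omega : n - k ≤ n + p),
    show n + p - (n - k) = p + k by omega]
  field_simp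

lemma hasSum_descFactorial_mul (k : ℕ) (z : ℝ) :
    HasSum (fun j : ℕ => (j.descFactorial k : ℝ) * (z ^ j / j !)) (z ^ k * Real.exp z) := by
  have h0 : ∑ j ∈ Finset.range k, (j.descFactorial k : ℝ) * (z ^ j / j !) = 0 :=
    Finset.sum_eq_zero fun j hj => by
      rw [Nat.descFactorial_of_lt (Finset.mem_range.mp hj)]; simp
  rw [← add_zero (z ^ k * Real.exp z), ← h0, ← hasSum_nat_add_iff k, Real.exp_eq_exp_ℝ]
  convert! (NormedSpace.expSeries_div_hasSum_exp z).mul_left (z ^ k) using 1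
  ext i
  have h := Nat.factorial_mul_descFactorial (Nat.le_add_left k i)
  rw [Nat.add_sub_cancel] at h
  rw [← h, Nat.cast_mul, pow_add]
  have : ((i + k).descFactorial k : ℝ) ≠ 0 := by
    exact_mod_cast (Nat.descFactorial_pos.mpr (Nat.le_add_left k i)).ne'
  field_simp

/-- Kummer's transformation of the confluent hypergeometric function `₁F₁(n + p + 1; p + 1; z)`. -/
lemma hasSum_kummer (n p : ℕ) (z : ℝ) :
    HasSum (fun j : ℕ => z ^ j / j ! * ((n + p + j)! / (p + j)!))
      (Real.exp z * ∑ k ∈ Finset.range (n + 1),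
        (n.choose k : ℝ) * ((n + p)! / (p + k)!) * z ^ k) := by
  have h := hasSum_sum (s := Finset.range (n + 1)) fun k _ =>
    (hasSum_descFactorial_mul k z).mul_left ((n.choose k : ℝ) * ((n + p)! / (p + k)!))
  convert! h using 1
  · ext j
    rw [← sum_choose_mul_descFactorial, Finset.mul_sum]
    exact Finset.sum_congr rfl fun k _ => by ring
  · rw [Finset.mul_sum]
    exact Finset.sum_congr rfl fun k _ => by ring

/-- The Poisson mixture of central Beta densities in closed form. -/
lemma hasSum_poisson_mul_betaPdf (q p : ℕ) (l x : ℝ) :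
    HasSum (fun j : ℕ => Real.exp (-l) * l ^ j / j ! * complexBetaPdf (q + 1) (p + 1 + j) x)
      (complexBetaPdf (q + 1) (p + 1) x * sinrFactor (q + 1) (p + 1) l x 1) := by
  have h := (hasSum_kummer (q + 1) p (l * (1 - x))).mul_left
    (Real.exp (-l) * x ^ q * (1 - x) ^ p / q !)
  convert! h using 1
  · ext j
    simp only [complexBetaPdf, Nat.add_sub_cancel]
    rw [show q + 1 + (p + 1 + j) - 1 = q + 1 + p + j by omega,
      show p + 1 + j - 1 = p + j by omega, mul_pow, pow_add (1 - x)]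
    field_simp
  · simp only [complexBetaPdf, sinrFactor, Nat.add_sub_cancel, mul_one]
    rw [show q + 1 + (p + 1) - 1 = q + 1 + p by omega,
      show -(l * x) = -l + l * (1 - x) by ring, Real.exp_add, Finset.mul_sum, Finset.mul_sum,
      Finset.mul_sum, Finset.mul_sum]
    refine Finset.sum_congr rfl fun k _ => ?_
    rw [show p + 1 + k - 1 = p + k by omega]
    field_simp

lemma complexBetaPdf_nonneg (n m : ℕ) {x : ℝ} (hx : x ∈ Set.Ioc (0 : ℝ) 1) :
    0 ≤ complexBetaPdf n m x := by
  have h0 := hx.1.le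
  have h1 : 0 ≤ 1 - x := sub_nonneg.mpr hx.2
  unfold complexBetaPdf
  positivity

lemma poissonGamma_zero (n : ℕ) : poissonGamma n 0 = gammaMeasure n 1 := by
  ext s hs
  rw [poissonGamma, Measure.sum_apply _ hs, tsum_eq_single 0 fun j hj => by simp [hj]]
  simp

/-- The density of the noncentral complex Beta distribution. -/
lemma complexBeta_eq_withDensity {n m : ℕ} (hn : 1 ≤ n) (hm : 1 ≤ m) (δ : ℝ) :
    complexBeta n m δ = volume.withDensity ((Set.Ioc 0 1).indicator
      fun x => ENNReal.ofReal (complexBetaPdf n m x * sinrFactor n m (δ ^ 2) x 1)) := by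
  obtain ⟨q, rfl⟩ : ∃ q, n = q + 1 := ⟨n - 1, by omega⟩
  obtain ⟨p, rfl⟩ : ∃ p, m = p + 1 := ⟨m - 1, by omega⟩
  have hg : ∀ k : ℕ, SFinite (gammaMeasure (k : ℝ) 1) := fun k => by
    unfold gammaMeasure; infer_instance
  have hmeas : Measurable fun v : ℝ × ℝ => 1 / (1 + v.1 / v.2) := by fun_prop
  rw [complexBeta, complexF, Measure.map_map (by fun_prop) (by fun_prop), complexChiSq_eq hm,
    complexChiSq_eq hn, zero_pow two_ne_zero, poissonGamma_zero, poissonGamma, Measure.prod_sum_left]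
  change Measure.map (fun v : ℝ × ℝ => 1 / (1 + v.1 / v.2)) _ = _
  rw [Measure.map_sum hmeas.aemeasurable]
  have hpdf : ∀ j, Measurable ((Set.Ioc 0 1).indicator
      fun x => ENNReal.ofReal (complexBetaPdf (q + 1) (p + 1 + j) x)) := fun j => by
    refine Measurable.indicator ?_ measurableSet_Ioc
    unfold complexBetaPdf; fun_prop
  have h1 : ∀ j : ℕ, (((ENNReal.ofReal (Real.exp (-δ ^ 2) * (δ ^ 2) ^ j / j !)) •
      gammaMeasure (p + 1 + j : ℕ) 1).prod (gammaMeasure (q + 1 : ℕ) 1)).map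
        (fun v => 1 / (1 + v.1 / v.2)) =
      volume.withDensity (ENNReal.ofReal (Real.exp (-δ ^ 2) * (δ ^ 2) ^ j / j !) •
        (Set.Ioc 0 1).indicator
          fun x => ENNReal.ofReal (complexBetaPdf (q + 1) (p + 1 + j) x)) := by
    intro j
    rw [withDensity_smul _ (hpdf j), Measure.prod_smul_left, Measure.map_smul]
    rw [show p + 1 + j = p + j + 1 by ring, gammaMeasure_prod_map]
  simp_rw [h1]
  rw [← withDensity_tsum fun j => (hpdf j).const_smul _]
  congr 1
  ext x
  rw [tsum_apply (Pi.summable.mpr fun _ => ENNReal.summable)]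
  by_cases hx : x ∈ Set.Ioc (0 : ℝ) 1
  · simp only [Pi.smul_apply, Set.indicator_of_mem hx, smul_eq_mul]
    have h := hasSum_poisson_mul_betaPdf q p (δ ^ 2) x
    rw [← h.tsum_eq, ENNReal.ofReal_tsum_of_nonneg _ h.summable]
    · congr 1
      ext j
      rw [ENNReal.ofReal_mul (by positivity)]
    · intro j
      exact mul_nonneg (by positivity) (complexBetaPdf_nonneg _ _ hx)
  · simp [Set.indicator_of_notMem hx]

lemma sinrFactor_zero (n m : ℕ) (x y : ℝ) : sinrFactor n m 0 x y = 1 := by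
  rw [sinrFactor, Finset.sum_eq_single 0]
  · have : ((m - 1)! : ℝ) ≠ 0 := by positivity
    simp [this]
  · intro k _ hk; simp [hk]
  · simp

end Beta

/-! ### The noncentral Hotelling statistic -/

section Measurability

variable {X ι : Type*} [MeasurableSpace X] [Fintype ι] [DecidableEq ι]

lemma measurable_det {A : X → Matrix ι ι ℂ} (hA : ∀ i j, Measurable fun x => A x i j) :
    Measurable fun x => (A x).det := by
  simp only [Matrix.det_apply]
  exact Finset.measurable_sum _ fun σ _ =>
    (Finset.measurable_prod _ fun i _ => hA _ _).const_smul (Equiv.Perm.sign σ)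

lemma measurable_matrix_inv {A : X → Matrix ι ι ℂ} (hA : ∀ i j, Measurable fun x => A x i j)
    (i j : ι) : Measurable fun x => (A x)⁻¹ i j := by
  simp only [Matrix.inv_def, Matrix.smul_apply, Ring.inverse_eq_inv', smul_eq_mul,
    Matrix.adjugate_apply]
  refine (measurable_det hA).inv.mul (measurable_det fun k l => ?_)
  rcases eq_or_ne k j with rfl | h
  · simp
  · simpa [Matrix.updateRow_ne h] using hA k l

omit [DecidableEq ι] in
lemma measurable_hermForm {A : X → Matrix ι ι ℂ} (hA : ∀ i j, Measurable fun x => A x i j)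
    {v : X → ι → ℂ} (hv : ∀ i, Measurable fun x => v x i) :
    Measurable fun x => hermForm (A x) (v x) := by
  unfold hermForm Matrix.mulVec dotProduct
  refine Complex.measurable_re.comp (Finset.measurable_sum _ fun i _ => ?_)
  exact (continuous_star.measurable.comp (hv i)).mul
    (Finset.measurable_sum _ fun j _ => (hA i j).mul (hv j))

omit [DecidableEq ι] in
lemma measurable_matrix_mul {m l : Type*} {A : X → Matrix m ι ℂ}
    (hA : ∀ i j, Measurable fun x => A x i j)
    {B : X → Matrix ι l ℂ} (hB : ∀ i j, Measurable fun x => B x i j) (i : m) (j : l) :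
    Measurable fun x => (A x * B x) i j := by
  simp only [Matrix.mul_apply]
  exact Finset.measurable_sum _ fun k _ => (hA i k).mul (hB k j)

omit [DecidableEq ι] in
lemma measurable_mulVec {m : Type*} {A : X → Matrix m ι ℂ}
    (hA : ∀ i j, Measurable fun x => A x i j)
    {v : X → ι → ℂ} (hv : ∀ i, Measurable fun x => v x i) (i : m) :
    Measurable fun x => (A x *ᵥ v x) i := by
  unfold Matrix.mulVec dotProduct
  exact Finset.measurable_sum _ fun k _ => (hA i k).mul (hv k)

end Measurability

/-- The Gram matrix `∑ k, X k (X k)†` of an array of column vectors. -/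
def gram {ι κ : Type*} [Fintype κ] (X : κ → ι → ℂ) : Matrix ι ι ℂ :=
  (Matrix.of fun i k => X k i) * (Matrix.of fun i k => X k i)ᴴ

lemma measurable_gram {X ι κ : Type*} [MeasurableSpace X] [Fintype κ] {f : X → κ → ι → ℂ}
    (hf : ∀ k i, Measurable fun x => f x k i) (i j : ι) : Measurable fun x => gram (f x) i j := by
  unfold gram
  exact measurable_matrix_mul (fun i k => hf k i)
    (fun k i => continuous_star.measurable.comp (hf k i)) i j

lemma Measure.map_prod_apply {α β γ : Type*} [MeasurableSpace α] [MeasurableSpace β]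
    [MeasurableSpace γ] (μ : Measure α) (ν : Measure β) [SFinite ν] {f : α × β → γ}
    (hf : Measurable f) {s : Set γ} (hs : MeasurableSet s) :
    (μ.prod ν).map f s = ∫⁻ a, ν.map (fun b => f (a, b)) s ∂μ := by
  rw [Measure.map_apply hf hs, Measure.prod_apply (hf hs)]
  exact lintegral_congr fun a => (Measure.map_apply (f := fun b => f (a, b))
    (hf.comp measurable_prodMk_left) hs).symm

section Hotelling

variable {κ : Type*} [Fintype κ] [DecidableEq κ]

omit [DecidableEq κ] in
lemma gram_vecMul {ι : Type*} [Fintype ι] (X : κ → ι → ℂ) (Q : Matrix ι ι ℂ) :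
    gram (fun k => X k ᵥ* Q) = Qᵀ * gram X * Qᵀᴴ := by
  have h : (Matrix.of fun i k => (X k ᵥ* Q) i) = Qᵀ * (Matrix.of fun i k => X k i) := by
    ext i k
    simp [Matrix.mul_apply, Matrix.vecMul, dotProduct, mul_comm]
  rw [gram, h, gram, Matrix.conjTranspose_mul, Matrix.mul_assoc, Matrix.mul_assoc, Matrix.mul_assoc]

lemma gaussianArray_eq_map_cons (d : ℕ) :
    ((gaussianArray (Fin d) κ).prod (complexNormal 0 1)).map
        (fun p => (Fin.cons p.2 p.1 : Fin (d + 1) → κ → ℂ)) = gaussianArray (Fin (d + 1)) κ := by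
  have h := (measurePreserving_piFinSuccAbove
      (fun _ : Fin (d + 1) => complexNormal (0 : κ → ℂ) 1) 0).symm.map_eq
  unfold gaussianArray
  rw [← h, ← Measure.prod_swap, Measure.map_map (by fun_prop) (by fun_prop)]
  congr 1
  ext p
  simp [Fin.insertNthEquiv]

/-- For a fixed vector `y` and a Gaussian array `W`, the form `y† (W W†)⁻¹ y` is distributed as
`|y|² / b` with `b` central chi-square: rotate `y` to a multiple of the first basis vector and apply
`hermForm_inv_single_zero`, conditionally on the other rows of `W`. -/
lemma gaussianArray_map_hermForm {d : ℕ} (hd : d + 1 ≤ Fintype.card κ) (y : Fin (d + 1) → ℂ) :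
    (gaussianArray κ (Fin (d + 1))).map (fun W => hermForm (gram W)⁻¹ y) =
      (complexChiSq (Fintype.card κ - d) 0).map fun b => (∑ i, ‖y i‖ ^ 2) / b := by
  obtain ⟨Q, hQ, hyQ⟩ := exists_unitary_vecMul y 0
  set c : ℝ := √(∑ i, ‖y i‖ ^ 2) with hc
  have hc2 : c ^ 2 = ∑ i, ‖y i‖ ^ 2 := Real.sq_sqrt (by positivity)
  have hdet : IsUnit Qᵀ.det := by
    rw [Matrix.det_transpose]
    exact (Matrix.isUnit_iff_isUnit_det _).mp (IsUnit.of_mul_eq_one_right _ hQ)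
  have hm : ∀ v : Fin (d + 1) → ℂ,
      Measurable fun W : κ → Fin (d + 1) → ℂ => hermForm (gram W)⁻¹ v := fun v =>
    measurable_hermForm (measurable_matrix_inv (measurable_gram fun k i => by fun_prop))
      fun i => measurable_const
  have hrot : ∀ W : κ → Fin (d + 1) → ℂ, hermForm (gram W)⁻¹ y =
      hermForm (gram fun k => W k ᵥ* Q)⁻¹ (Pi.single 0 (c : ℂ)) := by
    intro W
    rw [gram_vecMul, ← hyQ, ← Matrix.mulVec_transpose, hermForm_inv_congr hdet]
  have hQm : Measurable fun (W : κ → Fin (d + 1) → ℂ) k => W k ᵥ* Q :=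
    measurable_pi_lambda _ fun k => (measurable_vecMul Q).comp (measurable_pi_apply k)
  have hcons : Measurable fun p : (Fin d → κ → ℂ) × (κ → ℂ) =>
      (Fin.cons p.2 p.1 : Fin (d + 1) → κ → ℂ) := by fun_prop
  have h1 : (gaussianArray κ (Fin (d + 1))).map (fun W => hermForm (gram W)⁻¹ y) =
      ((gaussianArray (Fin d) κ).prod (complexNormal 0 1)).map fun p =>
        hermForm (gram fun k i => (Fin.cons p.2 p.1 : Fin (d + 1) → κ → ℂ) i k)⁻¹
          (Pi.single 0 (c : ℂ)) := by
    simp_rw [hrot]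
    rw [← Function.comp_def (f := fun W => hermForm (gram W)⁻¹ (Pi.single 0 (c : ℂ))),
      ← Measure.map_map (hm _) hQm, gaussianArray_map_vecMul hQ, ← gaussianArray_map_swap,
      ← gaussianArray_eq_map_cons, Measure.map_map (hm _) (by fun_prop),
      Measure.map_map ((hm _).comp (by fun_prop)) hcons]
    rfl
  have hF : Measurable fun p : (Fin d → κ → ℂ) × (κ → ℂ) =>
      hermForm (gram fun k i => (Fin.cons p.2 p.1 : Fin (d + 1) → κ → ℂ) i k)⁻¹
        (Pi.single 0 (c : ℂ)) :=
    (hm _).comp ((show Measurable fun (X : Fin (d + 1) → κ → ℂ) k i => X i k by fun_prop).comp hcons)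
  have hli : ∀ᵐ Z ∂gaussianArray (Fin d) κ, ∀ᵐ w ∂complexNormal (0 : κ → ℂ) 1,
      LinearIndependent ℂ (Fin.cons w Z : Fin (d + 1) → κ → ℂ) := by
    have := ae_linearIndependent (κ := κ) (d + 1) hd
    rw [← gaussianArray_eq_map_cons] at this
    exact Measure.ae_ae_of_ae_prod (ae_of_ae_map hcons.aemeasurable this)
  rw [h1]
  ext s hs
  rw [Measure.map_prod_apply _ _ hF hs]
  have hconst : ∀ᵐ Z ∂gaussianArray (Fin d) κ,
      (complexNormal (0 : κ → ℂ) 1).map (fun w =>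
        hermForm (gram fun k i => (Fin.cons w Z : Fin (d + 1) → κ → ℂ) i k)⁻¹
          (Pi.single 0 (c : ℂ))) s =
      (complexChiSq (Fintype.card κ - d) 0).map (fun b => (∑ i, ‖y i‖ ^ 2) / b) s := by
    filter_upwards [hli, ae_linearIndependent (κ := κ) d (by omega)] with Z hZ hZ'
    -- the component of `w` orthogonal to the rows of `Z` has coordinates `w ᵥ* V`
    obtain ⟨V, hV1, hV2, hV3⟩ := exists_kernel_basis (Matrix.of Z) (isUnit_det_mul_conjTranspose hZ')
    have hae : (fun w => hermForm (gram fun k i => (Fin.cons w Z : Fin (d + 1) → κ → ℂ) i k)⁻¹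
        (Pi.single 0 (c : ℂ))) =ᵐ[complexNormal (0 : κ → ℂ) 1]
        fun w => (∑ i, ‖y i‖ ^ 2) / ∑ j, ‖(w ᵥ* V) j‖ ^ 2 := by
      filter_upwards [hZ] with w hw
      rw [← hc2]
      exact hermForm_inv_single_zero w (Matrix.of Z) hV2 hV3
        (W := Matrix.of (Fin.cons w Z : Fin (d + 1) → κ → ℂ)) rfl (fun i => rfl)
        (isUnit_det_mul_conjTranspose hw) c
    rw [Measure.map_congr hae]
    have hN : Measurable fun x : Fin (Fintype.card κ - Fintype.card (Fin d)) → ℂ => ∑ j, ‖x j‖ ^ 2 := by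
      fun_prop
    have hne : Nonempty (Fin (Fintype.card κ - Fintype.card (Fin d))) :=
      ⟨⟨0, by rw [Fintype.card_fin]; omega⟩⟩
    have h2 : (complexNormal (0 : κ → ℂ) 1).map (fun w => ∑ j, ‖(w ᵥ* V) j‖ ^ 2) =
        complexChiSq (Fintype.card κ - d) 0 := by
      rw [← Function.comp_def (f := fun x : Fin _ → ℂ => ∑ j, ‖x j‖ ^ 2),
        ← Measure.map_map hN (measurable_vecMul V), complexNormal_map_vecMul hV1,
        complexNormal_map_normSq, complexChiSq_eq (by omega)]
      simp
    have hNV : Measurable fun w : κ → ℂ => ∑ j, ‖(w ᵥ* V) j‖ ^ 2 := hN.comp (measurable_vecMul V)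
    rw [← h2, Measure.map_map (by fun_prop) hNV]
    rfl
  rw [lintegral_congr_ae hconst, lintegral_const, measure_univ, mul_one]

/-- The noncentral complex version of Hotelling's theorem on the distribution of the
`T²`-statistic. -/
theorem map_hermForm_inv_gram {d : ℕ} (hd : d + 1 ≤ Fintype.card κ) (μ : Fin (d + 1) → ℂ) {δ : ℝ}
    (hδ : ∑ i, ‖μ i‖ ^ 2 = δ ^ 2) :
    ((complexNormal μ 1).prod (gaussianArray κ (Fin (d + 1)))).map
        (fun p => hermForm (gram p.2)⁻¹ p.1) =
      complexF (d + 1) (Fintype.card κ - d) δ := by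
  have hm : Measurable fun p : (Fin (d + 1) → ℂ) × (κ → Fin (d + 1) → ℂ) =>
      hermForm (gram p.2)⁻¹ p.1 :=
    measurable_hermForm (measurable_matrix_inv (measurable_gram fun k i => by fun_prop))
      fun i => by fun_prop
  have hN : Measurable fun x : Fin (d + 1) → ℂ => ∑ j, ‖x j‖ ^ 2 := by fun_prop
  have hp := isProbabilityMeasure_poissonGamma (n := Fintype.card κ - d) (l := 0 ^ 2) (by omega)
    (by positivity)
  rw [← complexChiSq_eq (by omega)] at hp
  have h1 : complexChiSq (d + 1) δ = (complexNormal μ 1).map fun x => ∑ j, ‖x j‖ ^ 2 := by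
    rw [complexChiSq_eq (by omega), complexNormal_map_normSq, hδ, Fintype.card_fin]
  have h2 : (complexChiSq (d + 1) δ).prod (complexChiSq (Fintype.card κ - d) 0) =
      ((complexNormal μ 1).prod (complexChiSq (Fintype.card κ - d) 0)).map
        (Prod.map (fun x => ∑ j, ‖x j‖ ^ 2) id) := by
    conv_lhs => rw [h1, ← Measure.map_id (μ := complexChiSq (Fintype.card κ - d) 0)]
    exact Measure.map_prod_map _ _ hN measurable_id
  rw [complexF, h2, Measure.map_map (by fun_prop) (by fun_prop)]
  ext s hs
  rw [Measure.map_prod_apply _ _ hm hs, Measure.map_prod_apply _ _ (by fun_prop) hs]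
  refine lintegral_congr fun y => ?_
  rw [gaussianArray_map_hermForm hd]
  rfl

end Hotelling

/-! ### The residual statistic given the third block -/

section Conditional

variable {κ σ : Type*} [Fintype κ] [DecidableEq κ] [Fintype σ] [DecidableEq σ]

lemma hermForm_smul {ι : Type*} [Fintype ι] (A : Matrix ι ι ℂ) (c : ℝ) (v : ι → ℂ) :
    hermForm A ((c : ℂ) • v) = c ^ 2 * hermForm A v := by
  simp only [hermForm, Matrix.mulVec_smul, star_smul, smul_dotProduct, dotProduct_smul, smul_eq_mul,
    Complex.star_def, Complex.conj_ofReal]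
  rw [Complex.re_ofReal_mul, Complex.re_ofReal_mul]
  ring

omit [DecidableEq κ] in
/-- `|Z† (Z Z†)⁻¹ z|² = z† (Z Z†)⁻¹ z`. -/
lemma sum_norm_sq_eq_hermForm (Z : Matrix σ κ ℂ) (hZ : IsUnit (Z * Zᴴ).det) (z : σ → ℂ) :
    ∑ k, ‖((Zᴴ * (Z * Zᴴ)⁻¹) *ᵥ z) k‖ ^ 2 = hermForm (Z * Zᴴ)⁻¹ z := by
  classical
  rw [← hermForm_one, ← hermForm_conjTranspose_mul_mul]
  congr 1
  rw [Matrix.mul_one, Matrix.conjTranspose_mul, Matrix.conjTranspose_conjTranspose,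
    Matrix.conjTranspose_nonsing_inv, Matrix.conjTranspose_mul, Matrix.conjTranspose_conjTranspose,
    Matrix.mul_assoc, ← Matrix.mul_assoc Z, Matrix.mul_nonsing_inv _ hZ, Matrix.mul_one]

/-- The orthonormal system in `ℂ^(1 + κ)` behind the conditional law of the residual: the normalized
vector `(1, -u)`, with `u = Z† (Z Z†)⁻¹ z` in the row space of `Z`, and the vectors `(0, v)` with
`v` in an orthonormal basis of the kernel of `Z`. -/
lemma exists_residual_basis (Z : Matrix σ κ ℂ) (hZ : IsUnit (Z * Zᴴ).det) (z : σ → ℂ) :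
    ∃ R : Matrix (Option κ) (Option (Fin (Fintype.card κ - Fintype.card σ))) ℂ, Rᴴ * R = 1 ∧
      ((√(1 + hermForm (Z * Zᴴ)⁻¹ z) : ℝ) : ℂ) • (fun k => R k none) =
        (fun k => k.elim 1 fun k => -((Zᴴ * (Z * Zᴴ)⁻¹) *ᵥ z) k) ∧
      (∀ j, R none (some j) = 0) ∧
      (R.submatrix some some * (R.submatrix some some)ᴴ) = 1 - Zᴴ * (Z * Zᴴ)⁻¹ * Z := by
  obtain ⟨Q, hQ1, hQ2, hQ3⟩ := exists_kernel_basis Z hZ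
  set u := (Zᴴ * (Z * Zᴴ)⁻¹) *ᵥ z with hu
  have hc := sum_norm_sq_eq_hermForm Z hZ z
  rw [← hu] at hc
  rw [← hc]
  set s : ℝ := √(1 + ∑ k, ‖u k‖ ^ 2) with hs
  have hs2 : s ^ 2 = 1 + ∑ k, ‖u k‖ ^ 2 := Real.sq_sqrt (by positivity)
  have hs0 : 0 < s := Real.sqrt_pos.mpr (by positivity)
  have hs0' : (s : ℂ) ≠ 0 := by exact_mod_cast hs0.ne'
  have huQ : star u ᵥ* Q = 0 := by
    rw [hu, Matrix.star_mulVec, Matrix.conjTranspose_mul, Matrix.conjTranspose_conjTranspose,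
      Matrix.vecMul_vecMul, Matrix.mul_assoc, hQ2]
    simp
  have huQ' : ∀ j, ∑ k, star (Q k j) * u k = 0 := by
    intro j
    have := congrArg star (congrFun huQ j)
    simpa [Matrix.vecMul, dotProduct, mul_comm] using this
  let R : Matrix (Option κ) (Option (Fin (Fintype.card κ - Fintype.card σ))) ℂ :=
    Matrix.of fun k j => j.elim ((s : ℂ)⁻¹ * k.elim 1 fun k => -u k)
      fun j => k.elim 0 fun k => Q k j
  refine ⟨R, ?_, ?_, fun j => rfl, ?_⟩
  · ext i j
    rw [Matrix.mul_apply, Fintype.sum_option]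
    simp only [Matrix.conjTranspose_apply]
    rcases i with _ | i <;> rcases j with _ | j
    · simp only [R, Matrix.of_apply, Option.elim, Matrix.one_apply_eq, star_mul', star_neg, star_one]
      have h1 : ∀ k, star ((s : ℂ)⁻¹) * -star (u k) * ((s : ℂ)⁻¹ * -u k) =
          (s : ℂ)⁻¹ ^ 2 * (‖u k‖ ^ 2 : ℝ) := by
        intro k
        rw [← Complex.normSq_eq_norm_sq, Complex.normSq_eq_conj_mul_self, star_inv₀,
          Complex.star_def, Complex.conj_ofReal]
        ring
      simp_rw [h1]
      rw [← Finset.mul_sum, ← Complex.ofReal_sum, star_inv₀, Complex.star_def, Complex.conj_ofReal,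
        show ∑ k, ‖u k‖ ^ 2 = s ^ 2 - 1 by rw [hs2]; ring]
      push_cast
      field_simp
      ring
    · have := congrFun huQ j
      simp only [Matrix.vecMul, dotProduct, Pi.star_apply, Pi.zero_apply] at this
      simp only [R, Matrix.of_apply, Option.elim, star_mul', star_neg, mul_zero, zero_add,
        mul_assoc, neg_mul, mul_neg, Finset.sum_neg_distrib, ← Finset.mul_sum, this]
      simp
    · have := huQ' i
      simp only [R, Matrix.of_apply, Option.elim, star_zero, zero_mul,
        mul_neg, Finset.sum_neg_distrib, mul_left_comm _ ((s : ℂ)⁻¹), ← Finset.mul_sum, this]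
      simp
    · have := congrFun (congrFun hQ1 i) j
      simp only [Matrix.mul_apply, Matrix.conjTranspose_apply] at this
      simp only [R, Matrix.of_apply, Option.elim, star_zero, zero_mul, zero_add, this,
        Matrix.one_apply, Option.some.injEq]
  · ext k
    simp only [R, Matrix.of_apply, Option.elim, Pi.smul_apply, smul_eq_mul]
    rw [mul_inv_cancel_left₀ hs0']
  · exact hQ3

/-- The conditional law of the normalized residual statistic, given the third block `X₃` of the
data: the residual has variance `1 + m₂` and is independent of the residual scatter matrix. -/
lemma gaussianArray_map_residual {d : ℕ} (hd : d + 1 + Fintype.card σ ≤ Fintype.card κ)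
    (Z : Matrix σ κ ℂ) (hZ : IsUnit (Z * Zᴴ).det) (z : σ → ℂ) (μ : Fin (d + 1) → ℂ) {δ : ℝ}
    (hδ : (∑ i, ‖μ i‖ ^ 2) * (1 / (1 + hermForm (Z * Zᴴ)⁻¹ z)) = δ ^ 2) :
    (gaussianArray (Option κ) (Fin (d + 1))).map (fun X =>
        hermForm (Matrix.of (fun i k => X (some k) i) * (1 - Zᴴ * (Z * Zᴴ)⁻¹ * Z) *
            (Matrix.of fun i k => X (some k) i)ᴴ)⁻¹
          (μ + X none - Matrix.of (fun i k => X (some k) i) *ᵥ (Zᴴ * (Z * Zᴴ)⁻¹) *ᵥ z) /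
          (1 + hermForm (Z * Zᴴ)⁻¹ z)) =
      complexF (d + 1) (Fintype.card κ - Fintype.card σ - d) δ := by
  obtain ⟨R, hR, hR0, hR1, hR2⟩ := exists_residual_basis Z hZ z
  have hc : 0 ≤ hermForm (Z * Zᴴ)⁻¹ z := by
    rw [← sum_norm_sq_eq_hermForm Z hZ z]; positivity
  set c := hermForm (Z * Zᴴ)⁻¹ z
  set s : ℝ := √(1 + c) with hs
  have hs2 : s ^ 2 = 1 + c := Real.sq_sqrt (by positivity)
  have hs0 : 0 < s := Real.sqrt_pos.mpr (by positivity)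
  have hs0' : (s : ℂ) ≠ 0 := by exact_mod_cast hs0.ne'
  set ν : Fin (d + 1) → ℂ := (s : ℂ)⁻¹ • μ with hν
  have hνδ : ∑ i, ‖ν i‖ ^ 2 = δ ^ 2 := by
    rw [← hδ, ← hs2, Finset.sum_mul]
    refine Finset.sum_congr rfl fun i _ => ?_
    simp only [hν, Pi.smul_apply, smul_eq_mul, norm_mul, norm_inv, Complex.norm_real,
      Real.norm_of_nonneg hs0.le]
    field_simp
  have hm : Measurable fun p : (Fin (d + 1) → ℂ) ×
      (Fin (Fintype.card κ - Fintype.card σ) → Fin (d + 1) → ℂ) => hermForm (gram p.2)⁻¹ p.1 :=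
    measurable_hermForm (measurable_matrix_inv (measurable_gram fun k i => by fun_prop))
      fun i => by fun_prop
  have hRm : Measurable fun (X : Option κ → Fin (d + 1) → ℂ) j a => ∑ k, X k a * R k j := by fun_prop
  have key : ∀ X : Option κ → Fin (d + 1) → ℂ,
      hermForm (Matrix.of (fun i k => X (some k) i) * (1 - Zᴴ * (Z * Zᴴ)⁻¹ * Z) *
            (Matrix.of fun i k => X (some k) i)ᴴ)⁻¹
          (μ + X none - Matrix.of (fun i k => X (some k) i) *ᵥ (Zᴴ * (Z * Zᴴ)⁻¹) *ᵥ z) / (1 + c) =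
      hermForm (gram fun j a => ∑ k, X k a * R k (some j))⁻¹
        ((fun a => ∑ k, X k a * R k none) + ν) := by
    intro X
    have h1 : gram (fun j a => ∑ k, X k a * R k (some j)) =
        Matrix.of (fun i k => X (some k) i) * (1 - Zᴴ * (Z * Zᴴ)⁻¹ * Z) *
            (Matrix.of fun i k => X (some k) i)ᴴ := by
      have h2 : (Matrix.of fun a j => ∑ k, X k a * R k (some j)) =
          Matrix.of (fun i k => X (some k) i) * R.submatrix some some := by
        ext a j
        simp [Matrix.mul_apply, Fintype.sum_option, hR1]
      rw [gram, h2, ← hR2, Matrix.conjTranspose_mul]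
      simp only [Matrix.mul_assoc]
    have h3 : μ + X none - Matrix.of (fun i k => X (some k) i) *ᵥ (Zᴴ * (Z * Zᴴ)⁻¹) *ᵥ z =
        (s : ℂ) • ((fun a => ∑ k, X k a * R k none) + ν) := by
      ext a
      have h4 : (s : ℂ) * ∑ k, X k a * R k none = ∑ k, X k a * ((s : ℂ) • fun k => R k none) k := by
        rw [Finset.mul_sum]
        exact Finset.sum_congr rfl fun k _ => by
          simp only [Pi.smul_apply, smul_eq_mul]; ring
      rw [hR0] at h4
      simp only [Pi.smul_apply, Pi.add_apply, Pi.sub_apply, smul_eq_mul, mul_add, hν,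
        mul_inv_cancel_left₀ hs0']
      rw [h4, Fintype.sum_option]
      simp only [Option.elim, mul_neg, Finset.sum_neg_distrib, mul_one]
      generalize (Zᴴ * (Z * Zᴴ)⁻¹) *ᵥ z = u
      simp only [Matrix.mulVec, dotProduct, Matrix.of_apply]
      ring
    rw [h1, h3, hermForm_smul, hs2, mul_div_cancel_left₀ _ (by positivity)]
  simp_rw [key]
  have hcard : d + 1 ≤ Fintype.card (Fin (Fintype.card κ - Fintype.card σ)) := by
    rw [Fintype.card_fin]; omega
  have hT := map_hermForm_inv_gram hcard ν hνδ
  rw [Fintype.card_fin] at hT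
  rw [← hT, ← complexNormal_map_add]
  have hprod : ((complexNormal (0 : Fin (d + 1) → ℂ) 1).map fun x => x + ν).prod
      (gaussianArray (Fin (Fintype.card κ - Fintype.card σ)) (Fin (d + 1))) =
      ((gaussianArray (Option κ) (Fin (d + 1))).map fun X j a => ∑ k, X k a * R k j).map
        fun Y => (Y none + ν, fun j => Y (some j)) := by
    conv_lhs => rw [← Measure.map_id
      (μ := gaussianArray (Fin (Fintype.card κ - Fintype.card σ)) (Fin (d + 1)))]
    rw [Measure.map_prod_map _ _ (by fun_prop) (by fun_prop), gaussianArray_map_sum_mul hR,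
      ← gaussianArray_map_option, Measure.map_map (by fun_prop) (by fun_prop)]
    rfl
  rw [hprod, Measure.map_map hm (by fun_prop), Measure.map_map (hm.comp (by fun_prop)) hRm]
  rfl

end Conditional

/-! ### The joint law of the statistics in the whitened model -/

section Kernel

lemma isProbabilityMeasure_complexBeta {n m : ℕ} (hn : 1 ≤ n) (hm : 1 ≤ m) (δ : ℝ) :
    IsProbabilityMeasure (complexBeta n m δ) := by
  have h1 := isProbabilityMeasure_poissonGamma hm (sq_nonneg δ)
  have h2 := isProbabilityMeasure_poissonGamma hn (sq_nonneg 0)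
  rw [← complexChiSq_eq hm] at h1
  rw [← complexChiSq_eq hn] at h2
  rw [complexBeta, complexF, Measure.map_map (by fun_prop) (by fun_prop)]
  exact Measure.isProbabilityMeasure_map (by fun_prop)

lemma measurable_complexBeta_density (n m : ℕ) (c : ℝ) :
    Measurable fun p : ℝ × ℝ => (Set.Ioc 0 1).indicator (fun x =>
      ENNReal.ofReal (complexBetaPdf n m x * sinrFactor n m (√(c * p.1) ^ 2) x 1)) p.2 := by
  have h : Measurable fun p : ℝ × ℝ => ENNReal.ofReal
      (complexBetaPdf n m p.2 * sinrFactor n m (√(c * p.1) ^ 2) p.2 1) := by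
    unfold complexBetaPdf sinrFactor; fun_prop
  exact h.indicator (s := {p : ℝ × ℝ | p.2 ∈ Set.Ioc 0 1}) (measurable_snd measurableSet_Ioc)

lemma measurable_complexBeta_sqrt {n m : ℕ} (hn : 1 ≤ n) (hm : 1 ≤ m) (c : ℝ) :
    Measurable fun y : ℝ => complexBeta n m √(c * y) := by
  refine Measure.measurable_of_measurable_coe _ fun s hs => ?_
  simp_rw [complexBeta_eq_withDensity hn hm, withDensity_apply _ hs]
  exact (measurable_complexBeta_density n m c).lintegral_prod_right'

/-- The Markov kernel `y ↦ Cβ_{n,m}(√(c y))`. -/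
noncomputable def complexBetaKernel {n m : ℕ} (hn : 1 ≤ n) (hm : 1 ≤ m) (c : ℝ) : Kernel ℝ ℝ where
  toFun y := complexBeta n m √(c * y)
  measurable' := measurable_complexBeta_sqrt hn hm c

instance {n m : ℕ} (hn : 1 ≤ n) (hm : 1 ≤ m) (c : ℝ) :
    IsMarkovKernel (complexBetaKernel hn hm c) :=
  ⟨fun _ => isProbabilityMeasure_complexBeta hn hm _⟩

lemma complexBeta_zero_eq_withDensity {n m : ℕ} (hn : 1 ≤ n) (hm : 1 ≤ m) :
    complexBeta n m 0 = volume.withDensity ((Set.Ioc 0 1).indicator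
      fun x => ENNReal.ofReal (complexBetaPdf n m x)) := by
  simp [complexBeta_eq_withDensity hn hm, sinrFactor_zero]

/-- The mixture of the noncentral laws `Cβ_{n,m}(√(c y))` over a central complex Beta variable `y`
has an explicit joint density: the noncentrality `c y` enters only through `sinrFactor`. -/
lemma compProd_complexBetaKernel_map_swap {n m n' m' : ℕ} (hn : 1 ≤ n) (hm : 1 ≤ m) (hn' : 1 ≤ n')
    (hm' : 1 ≤ m') {c : ℝ} (hc : 0 ≤ c) :
    (complexBeta n' m' 0 ⊗ₘ complexBetaKernel hn hm c).map Prod.swap =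
      unitSquareDensity fun x y =>
        complexBetaPdf n m x * complexBetaPdf n' m' y * sinrFactor n m c x y := by
  have hp := isProbabilityMeasure_complexBeta hn' hm' 0
  have hb : Measurable ((Set.Ioc 0 1).indicator
      fun x => ENNReal.ofReal (complexBetaPdf n' m' x)) := by
    refine Measurable.indicator ?_ measurableSet_Ioc
    unfold complexBetaPdf; fun_prop
  have hd : Measurable ((Set.Ioc 0 1 ×ˢ Set.Ioc 0 1).indicator fun p : ℝ × ℝ => ENNReal.ofReal
      (complexBetaPdf n m p.1 * complexBetaPdf n' m' p.2 * sinrFactor n m c p.1 p.2)) := by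
    refine Measurable.indicator ?_ (measurableSet_Ioc.prod measurableSet_Ioc)
    unfold complexBetaPdf sinrFactor; fun_prop
  have hκ := measurable_complexBeta_density n m c
  refine Measure.ext_of_lintegral _ fun g hg => ?_
  rw [lintegral_map hg measurable_swap, Measure.lintegral_compProd (f := fun p => g p.swap)
    (hg.comp measurable_swap),
    unitSquareDensity, lintegral_withDensity_eq_lintegral_mul _ hd hg, Measure.volume_eq_prod,
    lintegral_prod_symm' _ (hd.mul hg), complexBeta_zero_eq_withDensity hn' hm']
  have hin : Measurable fun y => ∫⁻ x, g (Prod.swap (y, x)) ∂complexBetaKernel hn hm c y :=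
    Measurable.lintegral_kernel_prod_right' (hg.comp measurable_swap)
  rw [lintegral_withDensity_eq_lintegral_mul _ hb hin]
  refine lintegral_congr fun y => ?_
  have h1 : complexBetaKernel hn hm c y = complexBeta n m √(c * y) := rfl
  have hdy : Measurable ((Set.Ioc 0 1).indicator fun x =>
      ENNReal.ofReal (complexBetaPdf n m x * sinrFactor n m (√(c * y) ^ 2) x 1)) :=
    hκ.comp (measurable_const.prodMk measurable_id)
  have hgy : Measurable fun x => g (Prod.swap (y, x)) :=
    hg.comp (measurable_swap.comp measurable_prodMk_left)
  rw [Pi.mul_apply, h1, complexBeta_eq_withDensity hn hm,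
    lintegral_withDensity_eq_lintegral_mul _ hdy hgy, ← lintegral_const_mul _ (hdy.mul hgy)]
  refine lintegral_congr fun x => ?_
  simp only [Pi.mul_apply, Prod.swap_prod_mk, ← mul_assoc]
  congr 1
  by_cases hy : y ∈ Set.Ioc (0 : ℝ) 1
  · by_cases hx : x ∈ Set.Ioc (0 : ℝ) 1
    · have hxy : (x, y) ∈ Set.Ioc (0 : ℝ) 1 ×ˢ Set.Ioc (0 : ℝ) 1 := ⟨hx, hy⟩
      rw [Set.indicator_of_mem hy, Set.indicator_of_mem hx, Set.indicator_of_mem hxy,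
        ← ENNReal.ofReal_mul (complexBetaPdf_nonneg _ _ hy),
        Real.sq_sqrt (mul_nonneg hc hy.1.le)]
      congr 1
      simp only [sinrFactor]
      rw [show c * y * x * 1 = c * x * y by ring, mul_one]
      ring
    · have hxy : (x, y) ∉ Set.Ioc (0 : ℝ) 1 ×ˢ Set.Ioc (0 : ℝ) 1 := fun h => hx h.1
      rw [Set.indicator_of_notMem hx, Set.indicator_of_notMem hxy, mul_zero]
  · have hxy : (x, y) ∉ Set.Ioc (0 : ℝ) 1 ×ˢ Set.Ioc (0 : ℝ) 1 := fun h => hy h.2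
    rw [Set.indicator_of_notMem hy, Set.indicator_of_notMem hxy, zero_mul]

/-- If `f (a, b)` has law `k (g a)` for almost every fixed `a`, then the joint law of
`(g a, f (a, b))` under a product measure is a composition product. -/
lemma Measure.prod_map_eq_compProd {α β γ γ' : Type*} [MeasurableSpace α] [MeasurableSpace β]
    [MeasurableSpace γ] [MeasurableSpace γ'] (μ : Measure α) (ν : Measure β) [SFinite μ] [SFinite ν]
    {g : α → γ} (hg : Measurable g) {f : α × β → γ'} (hf : Measurable f) (k : Kernel γ γ')
    [IsSFiniteKernel k] (h : ∀ᵐ a ∂μ, ν.map (fun b => f (a, b)) = k (g a)) :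
    (μ.prod ν).map (fun p => (g p.1, f p)) = μ.map g ⊗ₘ k := by
  ext s hs
  have hm : Measurable fun p : α × β => (g p.1, f p) := (hg.comp measurable_fst).prodMk hf
  rw [Measure.map_prod_apply _ _ hm hs, Measure.compProd_apply hs,
    lintegral_map (Kernel.measurable_kernel_prodMk_left hs) hg]
  refine lintegral_congr_ae ?_
  filter_upwards [h] with a ha
  have hfa : Measurable fun b => f (a, b) := hf.comp measurable_prodMk_left
  rw [← ha, Measure.map_apply hfa (measurable_prodMk_left hs),
    Measure.map_apply (f := fun b => (g a, f (a, b))) (measurable_const.prodMk hfa) hs]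
  rfl

end Kernel

section Core

variable {K r s : ℕ}

/-- The statistic `p₂` as a function of the third block of the whitened data. -/
noncomputable def whitenedP₂ (X₃ : Option (Fin K) → Fin s → ℂ) : ℝ :=
  1 / (1 + hermForm (gram fun k => X₃ (some k))⁻¹ (X₃ none))

/-- The statistic `p₁` as a function of the third and second blocks of the whitened data, when the
second block of the primary datum has mean `μ`. -/
noncomputable def whitenedP₁ (μ : Fin r → ℂ)
    (X : (Option (Fin K) → Fin s → ℂ) × (Option (Fin K) → Fin r → ℂ)) : ℝ :=
  let Z₃ : Matrix (Fin s) (Fin K) ℂ := Matrix.of fun i k => X.1 (some k) i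
  let Z₂ : Matrix (Fin r) (Fin K) ℂ := Matrix.of fun i k => X.2 (some k) i
  1 / (1 + hermForm (Z₂ * (1 - Z₃ᴴ * (Z₃ * Z₃ᴴ)⁻¹ * Z₃) * Z₂ᴴ)⁻¹
    (μ + X.2 none - Z₂ *ᵥ (Z₃ᴴ * (Z₃ * Z₃ᴴ)⁻¹) *ᵥ X.1 none) /
      (1 + hermForm (Z₃ * Z₃ᴴ)⁻¹ (X.1 none)))

lemma measurable_whitenedP₂ : Measurable (whitenedP₂ (K := K) (s := s)) := by
  unfold whitenedP₂
  have : Measurable fun X₃ : Option (Fin K) → Fin s → ℂ =>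
      hermForm (gram fun k => X₃ (some k))⁻¹ (X₃ none) :=
    measurable_hermForm (measurable_matrix_inv (measurable_gram fun k i => by fun_prop))
      fun i => by fun_prop
  fun_prop

lemma measurable_whitenedP₁ (μ : Fin r → ℂ) : Measurable (whitenedP₁ (K := K) (s := s) μ) := by
  unfold whitenedP₁
  simp only
  have hZ3 : ∀ i j, Measurable fun X : (Option (Fin K) → Fin s → ℂ) × (Option (Fin K) → Fin r → ℂ) =>
      (Matrix.of fun i k => X.1 (some k) i : Matrix (Fin s) (Fin K) ℂ) i j := fun i j => by
    simp only [Matrix.of_apply]; fun_prop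
  have hZ3' : ∀ i j, Measurable fun X : (Option (Fin K) → Fin s → ℂ) × (Option (Fin K) → Fin r → ℂ) =>
      (Matrix.of fun i k => X.1 (some k) i : Matrix (Fin s) (Fin K) ℂ)ᴴ i j := fun i j => by
    simp only [Matrix.conjTranspose_apply, Matrix.of_apply]; fun_prop
  have hZ2 : ∀ i j, Measurable fun X : (Option (Fin K) → Fin s → ℂ) × (Option (Fin K) → Fin r → ℂ) =>
      (Matrix.of fun i k => X.2 (some k) i : Matrix (Fin r) (Fin K) ℂ) i j := fun i j => by
    simp only [Matrix.of_apply]; fun_prop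
  have hZ2' : ∀ i j, Measurable fun X : (Option (Fin K) → Fin s → ℂ) × (Option (Fin K) → Fin r → ℂ) =>
      (Matrix.of fun i k => X.2 (some k) i : Matrix (Fin r) (Fin K) ℂ)ᴴ i j := fun i j => by
    simp only [Matrix.conjTranspose_apply, Matrix.of_apply]; fun_prop
  have hinv := measurable_matrix_inv (measurable_matrix_mul hZ3 hZ3')
  have hproj := measurable_matrix_mul (measurable_matrix_mul hZ3' hinv) hZ3
  have h2 := measurable_hermForm hinv (v := fun X :
    (Option (Fin K) → Fin s → ℂ) × (Option (Fin K) → Fin r → ℂ) => X.1 none) fun i => by fun_prop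
  have hone : ∀ i j, Measurable fun X :
      (Option (Fin K) → Fin s → ℂ) × (Option (Fin K) → Fin r → ℂ) =>
      (1 - (Matrix.of fun i k => X.1 (some k) i)ᴴ * ((Matrix.of fun i k => X.1 (some k) i) *
        (Matrix.of fun i k => X.1 (some k) i)ᴴ)⁻¹ * (Matrix.of fun i k => X.1 (some k) i) :
          Matrix (Fin K) (Fin K) ℂ) i j := fun i j => by
    simp only [Matrix.sub_apply]
    exact measurable_const.sub (hproj i j)
  have h1 := measurable_hermForm (measurable_matrix_inv
    (measurable_matrix_mul (measurable_matrix_mul hZ2 hone) hZ2')) (v := fun X =>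
      μ + X.2 none - (Matrix.of fun i k => X.2 (some k) i : Matrix (Fin r) (Fin K) ℂ) *ᵥ
        ((Matrix.of fun i k => X.1 (some k) i)ᴴ * ((Matrix.of fun i k => X.1 (some k) i) *
        (Matrix.of fun i k => X.1 (some k) i)ᴴ)⁻¹) *ᵥ X.1 none) fun i => by
    have h5 := measurable_mulVec hZ2 (measurable_mulVec (measurable_matrix_mul hZ3' hinv)
      (v := fun X : (Option (Fin K) → Fin s → ℂ) × (Option (Fin K) → Fin r → ℂ) => X.1 none)
      fun i => by fun_prop) i
    simp only [Pi.sub_apply, Pi.add_apply]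
    exact Measurable.sub (by fun_prop) h5
  exact measurable_const.div (measurable_const.add (h1.div (measurable_const.add h2)))

lemma ae_isUnit_det_gram (hs : s ≤ K) : ∀ᵐ X ∂gaussianArray (Option (Fin K)) (Fin s),
    IsUnit (gram fun k => X (some k)).det := by
  have h1 : ∀ᵐ W ∂gaussianArray (Fin K) (Fin s), IsUnit (gram W).det := by
    have h := ae_linearIndependent (κ := Fin K) s (by simpa using hs)
    rw [← gaussianArray_map_swap] at h
    filter_upwards [ae_of_ae_map (show Measurable fun (X : Fin K → Fin s → ℂ) k i => X i k by
      fun_prop).aemeasurable h] with W hW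
    exact isUnit_det_mul_conjTranspose (Z := Matrix.of fun i k => W k i) hW
  have h2 : ∀ᵐ p ∂(complexNormal (0 : Fin s → ℂ) 1).prod (gaussianArray (Fin K) (Fin s)),
      IsUnit (gram p.2).det := measurePreserving_snd.quasiMeasurePreserving.ae h1
  rw [← gaussianArray_map_option] at h2
  exact ae_of_ae_map (show Measurable fun X : Option (Fin K) → Fin s → ℂ =>
    (X none, fun k => X (some k)) by fun_prop).aemeasurable h2

/-- The joint law of `(p₂, p₁)` in the whitened model. -/
theorem gaussianArray_map_whitened (hr : 1 ≤ r) (hs : 1 ≤ s) (hrs : r + s ≤ K) (μ : Fin r → ℂ)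
    {c : ℝ}
    (hμ : ∑ i, ‖μ i‖ ^ 2 = c) {n n' : ℕ} (hn : 1 ≤ n) (hn2 : n + r + s = K + 1)
    (hn' : n' + s = K + 1) :
    ((gaussianArray (Option (Fin K)) (Fin s)).prod (gaussianArray (Option (Fin K)) (Fin r))).map
        (fun p => (whitenedP₂ p.1, whitenedP₁ μ p)) =
      complexBeta n' s 0 ⊗ₘ complexBetaKernel hn hr c := by
  have h2 : (gaussianArray (Option (Fin K)) (Fin s)).map whitenedP₂ = complexBeta n' s 0 := by
    obtain ⟨d, rfl⟩ : ∃ d, s = d + 1 := ⟨s - 1, by omega⟩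
    have h := map_hermForm_inv_gram (κ := Fin K) (d := d) (by rw [Fintype.card_fin]; omega) 0 (δ := 0)
      (by simp)
    have hm : Measurable fun p : (Fin (d + 1) → ℂ) × (Fin K → Fin (d + 1) → ℂ) =>
        hermForm (gram p.2)⁻¹ p.1 :=
      measurable_hermForm (measurable_matrix_inv (measurable_gram fun k i => by fun_prop))
        fun i => by fun_prop
    rw [Fintype.card_fin, show K - d = n' by omega] at h
    rw [complexBeta, ← h, ← gaussianArray_map_option, Measure.map_map hm (by fun_prop),
      Measure.map_map (by fun_prop) (hm.comp (by fun_prop))]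
    rfl
  rw [← h2]
  refine Measure.prod_map_eq_compProd _ _ measurable_whitenedP₂ (measurable_whitenedP₁ μ) _ ?_
  filter_upwards [ae_isUnit_det_gram (K := K) (s := s) (by omega)] with X₃ hX₃
  obtain ⟨d, rfl⟩ : ∃ d, r = d + 1 := ⟨r - 1, by omega⟩
  set Z : Matrix (Fin s) (Fin K) ℂ := Matrix.of fun i k => X₃ (some k) i with hZ
  have hpos : 0 ≤ hermForm (Z * Zᴴ)⁻¹ (X₃ none) := by
    rw [← sum_norm_sq_eq_hermForm Z hX₃]; positivity
  have hp2 : whitenedP₂ X₃ = 1 / (1 + hermForm (Z * Zᴴ)⁻¹ (X₃ none)) := rfl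
  have hc : 0 ≤ c := by rw [← hμ]; positivity
  have h := gaussianArray_map_residual (κ := Fin K) (σ := Fin s) (d := d)
    (by simp only [Fintype.card_fin]; omega) Z hX₃ (X₃ none) μ (δ := √(c * whitenedP₂ X₃))
    (by rw [hμ, hp2, Real.sq_sqrt (by positivity)])
  change _ = complexBeta n (d + 1) √(c * whitenedP₂ X₃)
  rw [Fintype.card_fin, Fintype.card_fin, show K - s - d = n by omega] at h
  have hm1 : AEMeasurable (fun X : Option (Fin K) → Fin (d + 1) → ℂ =>
        hermForm (Matrix.of (fun i k => X (some k) i) * (1 - Zᴴ * (Z * Zᴴ)⁻¹ * Z) *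
            (Matrix.of fun i k => X (some k) i)ᴴ)⁻¹
          (μ + X none - Matrix.of (fun i k => X (some k) i) *ᵥ (Zᴴ * (Z * Zᴴ)⁻¹) *ᵥ X₃ none) /
          (1 + hermForm (Z * Zᴴ)⁻¹ (X₃ none))) (gaussianArray (Option (Fin K)) (Fin (d + 1))) := by
    -- otherwise its law would be the zero measure instead of a probability measure
    by_contra hcon
    rw [Measure.map_of_not_aemeasurable hcon] at h
    have hb := isProbabilityMeasure_complexBeta hn hr √(c * whitenedP₂ X₃)
    rw [complexBeta, ← h, Measure.map_zero] at hb
    have h0 := hb.measure_univ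
    rw [Measure.coe_zero, Pi.zero_apply] at h0
    exact zero_ne_one h0
  rw [complexBeta, ← h, AEMeasurable.map_map_of_aemeasurable (by fun_prop) hm1]
  rfl

end Core

/-! ### Block triangular factorizations and invariance of the statistics -/

section Whitening

open scoped MatrixOrder Matrix.Norms.L2Operator in
lemma Matrix.PosSemidef.exists_mul_conjTranspose {ι : Type*} [Fintype ι] [DecidableEq ι]
    {A : Matrix ι ι ℂ} (hA : A.PosSemidef) : ∃ C : Matrix ι ι ℂ, C * Cᴴ = A := by
  obtain ⟨C, hC⟩ := CStarAlgebra.nonneg_iff_eq_star_mul_self.mp hA.nonneg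
  exact ⟨Cᴴ, by rw [Matrix.conjTranspose_conjTranspose, hC]; rfl⟩

/-- A factorization of the lower right block of a positive definite matrix extends to a block upper
triangular factorization of the whole matrix. -/
lemma Matrix.PosDef.exists_fromBlocks_mul_conjTranspose {α β : Type*} [Fintype α] [DecidableEq α]
    [Fintype β] [DecidableEq β] {M : Matrix (α ⊕ β) (α ⊕ β) ℂ} (hM : M.PosDef)
    {C : Matrix β β ℂ} (hC : C * Cᴴ = M.toBlocks₂₂) :
    ∃ (A : Matrix α α ℂ) (B : Matrix α β ℂ),
      Matrix.fromBlocks A B 0 C * (Matrix.fromBlocks A B 0 C)ᴴ = M := by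
  have hD : M.toBlocks₂₂.PosDef := hM.submatrix Sum.inr_injective
  have hDu : IsUnit M.toBlocks₂₂.det := hD.det_pos.ne'.isUnit
  have hCu : IsUnit C.det := by
    rw [← hC, Matrix.det_mul] at hDu
    exact isUnit_of_mul_isUnit_left hDu
  have hCu' : IsUnit Cᴴ.det := by rw [Matrix.det_conjTranspose]; exact hCu.star
  have h21 : M.toBlocks₂₁ = M.toBlocks₁₂ᴴ := by
    ext i j
    exact (hM.1.apply _ _).symm
  let _ : Invertible M.toBlocks₂₂ := Matrix.invertibleOfIsUnitDet _ hDu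
  have hS : (M.toBlocks₁₁ - M.toBlocks₁₂ * M.toBlocks₂₂⁻¹ * M.toBlocks₁₂ᴴ).PosSemidef := by
    rw [← Matrix.PosDef.fromBlocks₂₂ _ _ hD, ← h21, Matrix.fromBlocks_toBlocks]
    exact hM.posSemidef
  obtain ⟨A, hA⟩ := hS.exists_mul_conjTranspose
  refine ⟨A, M.toBlocks₁₂ * Cᴴ⁻¹, ?_⟩
  have hinv : Cᴴ⁻¹ * (Cᴴ⁻¹)ᴴ = M.toBlocks₂₂⁻¹ := by
    rw [← hC, Matrix.mul_inv_rev, Matrix.conjTranspose_nonsing_inv, Matrix.conjTranspose_conjTranspose]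
  conv_rhs => rw [← Matrix.fromBlocks_toBlocks M]
  rw [Matrix.fromBlocks_conjTranspose, Matrix.fromBlocks_multiply]
  congr 1
  · rw [hA, Matrix.conjTranspose_mul, ← Matrix.mul_assoc, Matrix.mul_assoc M.toBlocks₁₂ Cᴴ⁻¹, hinv,
      sub_add_cancel]
  · rw [Matrix.conjTranspose_zero, Matrix.mul_zero, zero_add, Matrix.mul_assoc,
      Matrix.nonsing_inv_mul _ hCu', Matrix.mul_one]
  · rw [Matrix.zero_mul, zero_add, h21, Matrix.conjTranspose_mul, ← Matrix.mul_assoc,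
      ← Matrix.conjTranspose_nonsing_inv, Matrix.conjTranspose_conjTranspose,
      Matrix.mul_nonsing_inv _ hCu, Matrix.one_mul]
  · rw [Matrix.zero_mul, zero_add, hC]

section

variable {α β : Type*} [Fintype α] [Fintype β] [DecidableEq β]
  {D : Matrix α α ℂ} {E : Matrix α β ℂ} {C : Matrix β β ℂ} {L₁₁ : Matrix α α ℂ}
  {L₁₂ : Matrix α β ℂ} {L₂₁ : Matrix β α ℂ} {L₂₂ : Matrix β β ℂ}

lemma regression_congr (hC : IsUnit C.det) (hL : IsUnit L₂₂.det) :
    (D * L₁₂ + E * L₂₂) * Cᴴ * (C * L₂₂ * Cᴴ)⁻¹ = (D * L₁₂ * L₂₂⁻¹ + E) * C⁻¹ := by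
  have hC' : IsUnit Cᴴ.det := by rw [Matrix.det_conjTranspose]; exact hC.star
  rw [Matrix.mul_inv_rev, Matrix.mul_inv_rev, Matrix.mul_assoc, Matrix.mul_nonsing_inv_cancel_left _ _ hC',
    ← Matrix.mul_assoc, Matrix.add_mul, Matrix.mul_nonsing_inv_cancel_right _ _ hL]

lemma schurComplement_congr (hC : IsUnit C.det) (hL : IsUnit L₂₂.det) :
    (D * L₁₁ + E * L₂₁) * Dᴴ + (D * L₁₂ + E * L₂₂) * Eᴴ -
      (D * L₁₂ + E * L₂₂) * Cᴴ * (C * L₂₂ * Cᴴ)⁻¹ * (C * L₂₁ * Dᴴ + C * L₂₂ * Eᴴ) =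
      D * (L₁₁ - L₁₂ * L₂₂⁻¹ * L₂₁) * Dᴴ := by
  rw [regression_congr hC hL, Matrix.mul_assoc C, Matrix.mul_assoc C, ← Matrix.mul_add,
    Matrix.mul_assoc _ C⁻¹, Matrix.nonsing_inv_mul_cancel_left _ _ hC]
  simp only [Matrix.add_mul, Matrix.mul_add, Matrix.mul_sub, Matrix.sub_mul, Matrix.mul_assoc,
    Matrix.nonsing_inv_mul_cancel_left _ _ hL]
  abel

lemma residual_congr (hC : IsUnit C.det) (hL : IsUnit L₂₂.det) (u : α → ℂ) (v : β → ℂ) :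
    D *ᵥ u + E *ᵥ v - ((D * L₁₂ + E * L₂₂) * Cᴴ * (C * L₂₂ * Cᴴ)⁻¹) *ᵥ C *ᵥ v =
      D *ᵥ (u - (L₁₂ * L₂₂⁻¹) *ᵥ v) := by
  rw [regression_congr hC hL, Matrix.mulVec_mulVec, Matrix.mul_assoc, Matrix.nonsing_inv_mul _ hC,
    Matrix.mul_one, Matrix.add_mulVec, Matrix.mulVec_sub, Matrix.mulVec_mulVec, Matrix.mul_assoc]
  abel

end

namespace Channel

variable {N t r : ℕ}

/-- A block upper triangular matrix on the channels. -/
def upperTriangular (A : Matrix (Fin t) (Fin t) ℂ)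
    (B : Matrix (Fin t) (Fin r ⊕ Fin (N - (t + r))) ℂ) (D : Matrix (Fin r) (Fin r) ℂ)
    (E : Matrix (Fin r) (Fin (N - (t + r))) ℂ)
    (C : Matrix (Fin (N - (t + r))) (Fin (N - (t + r))) ℂ) :
    Matrix (Channel N t r) (Channel N t r) ℂ :=
  Matrix.fromBlocks A B 0 (Matrix.fromBlocks D E 0 C)

lemma exists_upperTriangular {M : Matrix (Channel N t r) (Channel N t r) ℂ} (hM : M.PosDef) :
    ∃ A B D E C, upperTriangular A B D E C * (upperTriangular A B D E C)ᴴ = M := by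
  have h2 : M.toBlocks₂₂.PosDef := hM.submatrix Sum.inr_injective
  have h3 : M.toBlocks₂₂.toBlocks₂₂.PosDef := h2.submatrix Sum.inr_injective
  obtain ⟨C, hC⟩ := h3.posSemidef.exists_mul_conjTranspose
  obtain ⟨D, E, hDE⟩ := h2.exists_fromBlocks_mul_conjTranspose hC
  obtain ⟨A, B, hAB⟩ := hM.exists_fromBlocks_mul_conjTranspose hDE
  exact ⟨A, B, D, E, C, hAB⟩

variable {A : Matrix (Fin t) (Fin t) ℂ} {B : Matrix (Fin t) (Fin r ⊕ Fin (N - (t + r))) ℂ}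
  {D : Matrix (Fin r) (Fin r) ℂ} {E : Matrix (Fin r) (Fin (N - (t + r))) ℂ}
  {C : Matrix (Fin (N - (t + r))) (Fin (N - (t + r))) ℂ}

lemma isUnit_det_of_upperTriangular (h : IsUnit (upperTriangular A B D E C).det) :
    IsUnit D.det ∧ IsUnit C.det := by
  rw [upperTriangular, Matrix.det_fromBlocks_zero₂₁, Matrix.det_fromBlocks_zero₂₁] at h
  exact ⟨isUnit_of_mul_isUnit_left (isUnit_of_mul_isUnit_right h),
    isUnit_of_mul_isUnit_right (isUnit_of_mul_isUnit_right h)⟩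

/-- Only the last two blocks of the variable matter for the last two blocks of its image under a
block upper triangular congruence. -/
lemma toBlocks₂₂_upperTriangular_congr (S : Matrix (Channel N t r) (Channel N t r) ℂ) :
    (upperTriangular A B D E C * S * (upperTriangular A B D E C)ᴴ).toBlocks₂₂ =
      Matrix.fromBlocks
        ((D * S.submatrix two two + E * S.submatrix three two) * Dᴴ +
          (D * S.submatrix two three + E * S.submatrix three three) * Eᴴ)
        ((D * S.submatrix two three + E * S.submatrix three three) * Cᴴ)
        (C * S.submatrix three two * Dᴴ + C * S.submatrix three three * Eᴴ)
        (C * S.submatrix three three * Cᴴ) := by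
  have h : S = Matrix.fromBlocks S.toBlocks₁₁ S.toBlocks₁₂ S.toBlocks₂₁ (Matrix.fromBlocks
      (S.submatrix two two) (S.submatrix two three) (S.submatrix three two)
      (S.submatrix three three)) := by
    ext (i | i | i) (j | j | j) <;> rfl
  conv_lhs => rw [h]
  simp only [upperTriangular, Matrix.fromBlocks_conjTranspose, Matrix.fromBlocks_multiply,
    Matrix.toBlocks_fromBlocks₂₂, Matrix.conjTranspose_zero, Matrix.mul_zero, Matrix.zero_mul,
    zero_add]

lemma submatrix_three_three_congr (S : Matrix (Channel N t r) (Channel N t r) ℂ) :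
    (upperTriangular A B D E C * S * (upperTriangular A B D E C)ᴴ).submatrix three three =
      C * S.submatrix three three * Cᴴ :=
  congrArg Matrix.toBlocks₂₂ (toBlocks₂₂_upperTriangular_congr S)

lemma submatrix_two_three_congr (S : Matrix (Channel N t r) (Channel N t r) ℂ) :
    (upperTriangular A B D E C * S * (upperTriangular A B D E C)ᴴ).submatrix two three =
      (D * S.submatrix two three + E * S.submatrix three three) * Cᴴ :=
  congrArg Matrix.toBlocks₁₂ (toBlocks₂₂_upperTriangular_congr S)

lemma submatrix_three_two_congr (S : Matrix (Channel N t r) (Channel N t r) ℂ) :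
    (upperTriangular A B D E C * S * (upperTriangular A B D E C)ᴴ).submatrix three two =
      C * S.submatrix three two * Dᴴ + C * S.submatrix three three * Eᴴ :=
  congrArg Matrix.toBlocks₂₁ (toBlocks₂₂_upperTriangular_congr S)

lemma submatrix_two_two_congr (S : Matrix (Channel N t r) (Channel N t r) ℂ) :
    (upperTriangular A B D E C * S * (upperTriangular A B D E C)ᴴ).submatrix two two =
      (D * S.submatrix two two + E * S.submatrix three two) * Dᴴ +
        (D * S.submatrix two three + E * S.submatrix three three) * Eᴴ :=
  congrArg Matrix.toBlocks₁₁ (toBlocks₂₂_upperTriangular_congr S)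

lemma upperTriangular_mulVec_three (z : Channel N t r → ℂ) :
    (fun j => (upperTriangular A B D E C *ᵥ z) (three j)) = C *ᵥ fun j => z (three j) := by
  ext j
  simp [upperTriangular, Matrix.mulVec, dotProduct, three]

lemma upperTriangular_mulVec_two (z : Channel N t r → ℂ) :
    (fun j => (upperTriangular A B D E C *ᵥ z) (two j)) =
      D *ᵥ (fun j => z (two j)) + E *ᵥ fun j => z (three j) := by
  ext j
  simp [upperTriangular, Matrix.mulVec, dotProduct, two, three]

variable {S : Matrix (Channel N t r) (Channel N t r) ℂ}

lemma schur_congr (hC : IsUnit C.det) (hS : IsUnit (S.submatrix three three).det) :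
    schur (upperTriangular A B D E C * S * (upperTriangular A B D E C)ᴴ) = D * schur S * Dᴴ := by
  rw [schur, submatrix_two_two_congr, submatrix_two_three_congr, submatrix_three_three_congr,
    submatrix_three_two_congr, schurComplement_congr hC hS, schur]

lemma resid_congr (hC : IsUnit C.det) (hS : IsUnit (S.submatrix three three).det)
    (z : Channel N t r → ℂ) :
    resid (upperTriangular A B D E C *ᵥ z)
      (upperTriangular A B D E C * S * (upperTriangular A B D E C)ᴴ) = D *ᵥ resid z S := by
  rw [resid, submatrix_two_three_congr, submatrix_three_three_congr, upperTriangular_mulVec_two,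
    upperTriangular_mulVec_three, residual_congr hC hS, resid]

lemma m₁_congr (hT : IsUnit (upperTriangular A B D E C).det)
    (hS : IsUnit (S.submatrix three three).det) (z : Channel N t r → ℂ) :
    m₁ (upperTriangular A B D E C *ᵥ z)
      (upperTriangular A B D E C * S * (upperTriangular A B D E C)ᴴ) = m₁ z S := by
  obtain ⟨hD, hC⟩ := isUnit_det_of_upperTriangular hT
  rw [m₁, schur_congr hC hS, resid_congr hC hS, hermForm_inv_congr hD, m₁]

lemma m₂_congr (hT : IsUnit (upperTriangular A B D E C).det) (z : Channel N t r → ℂ) :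
    m₂ (upperTriangular A B D E C *ᵥ z)
      (upperTriangular A B D E C * S * (upperTriangular A B D E C)ᴴ) = m₂ z S := by
  obtain ⟨hD, hC⟩ := isUnit_det_of_upperTriangular hT
  rw [m₂, submatrix_three_three_congr, upperTriangular_mulVec_three, hermForm_inv_congr hC, m₂]

/-- After whitening, the SINR is the squared norm of the mean of the second block. -/
lemma SINR_upperTriangular (hT : IsUnit (upperTriangular A B D E C).det) (v : Fin r → ℂ) :
    SINR (D *ᵥ v) (upperTriangular A B D E C * (upperTriangular A B D E C)ᴴ) =
      ∑ i, ‖v i‖ ^ 2 := by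
  obtain ⟨hD, hC⟩ := isUnit_det_of_upperTriangular hT
  have h33 : (1 : Matrix (Channel N t r) (Channel N t r) ℂ).submatrix three three = 1 :=
    Matrix.submatrix_one _ (Sum.inr_injective.comp Sum.inr_injective)
  have h22 : (1 : Matrix (Channel N t r) (Channel N t r) ℂ).submatrix two two = 1 :=
    Matrix.submatrix_one _ (Sum.inr_injective.comp Sum.inl_injective)
  have h23 : (1 : Matrix (Channel N t r) (Channel N t r) ℂ).submatrix two three = 0 := by
    ext i j; simp [two, three, Matrix.one_apply]
  have hs : schur (1 : Matrix (Channel N t r) (Channel N t r) ℂ) = 1 := by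
    rw [schur, h22, h23, Matrix.zero_mul, Matrix.zero_mul, sub_zero]
  have h := schur_congr (A := A) (B := B) (D := D) (E := E) (C := C) (S := 1) hC (by simp [h33])
  rw [Matrix.mul_one, hs] at h
  rw [SINR, h, hermForm_inv_congr hD, inv_one, hermForm_one]

end Channel

end Whitening

/-! ### Reduction to the whitened model -/

section Statistics

lemma complexNormal_map_inv_mulVec {ι : Type*} [Fintype ι] [DecidableEq ι] {M T : Matrix ι ι ℂ}
    (hM : 0 ≤ M.det.re) (hT : IsUnit T.det) (hTM : T * Tᴴ = M)
    (hP : IsProbabilityMeasure (complexNormal 0 M)) :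
    (complexNormal 0 M).map (fun x => T⁻¹ *ᵥ x) = complexNormal 0 1 := by
  have hT' : IsUnit T⁻¹.det := (Matrix.isUnit_nonsing_inv_det_iff).mpr hT
  let f : (ι → ℂ) ≃ₗ[ℝ] (ι → ℂ) :=
    (Matrix.toLinearEquiv' T⁻¹ (T⁻¹.invertibleOfIsUnitDet hT')).restrictScalars ℝ
  have h := (complexNormal_hasGibbsDensity 0 hM hP).map_linear inferInstance inferInstance f
    (q' := fun x => ∑ i, ‖x i - (0 : ι → ℂ) i‖ ^ 2) (by fun_prop) fun x => by
      have : f x = T⁻¹ *ᵥ x := rfl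
      rw [this]
      simp only [Pi.zero_apply, sub_zero]
      rw [← hermForm_one, ← hTM]
      conv_rhs => rw [show x = T *ᵥ T⁻¹ *ᵥ x by
        rw [Matrix.mulVec_mulVec, Matrix.mul_nonsing_inv _ hT, Matrix.one_mulVec]]
      have := hermForm_inv_congr hT 1 (T⁻¹ *ᵥ x)
      rw [Matrix.mul_one, inv_one] at this
      exact this.symm
  exact h.eq (hasGibbsDensity_complexNormal_one 0)

lemma aemeasurable_and_map_eq_of_ae_eq_comp {Ω α β : Type*} [MeasurableSpace Ω]
    [MeasurableSpace α] [MeasurableSpace β] {P : Measure Ω} {W : Ω → α} (hW : AEMeasurable W P)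
    {G : α → β} (hG : Measurable G) {U : Ω → β}
    (h : ∀ᵐ ω ∂P, U ω = G (W ω)) : AEMeasurable U P ∧ P.map U = (P.map W).map G := by
  refine ⟨(hG.comp_aemeasurable hW).congr (h.mono fun ω h => h.symm), ?_⟩
  rw [Measure.map_congr h, AEMeasurable.map_map_of_aemeasurable hG.aemeasurable hW]
  rfl

namespace Channel

variable {N t r K : ℕ}

lemma scatter_mulVec (T : Matrix (Channel N t r) (Channel N t r) ℂ)
    (W : Fin K → Channel N t r → ℂ) :
    scatter (fun k => T *ᵥ W k) = T * scatter W * Tᴴ := by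
  have h : (Matrix.of fun i k => (T *ᵥ W k) i : Matrix (Channel N t r) (Fin K) ℂ) =
      T * Matrix.of fun i k => W k i := by
    ext i k; rfl
  rw [scatter, h, Matrix.conjTranspose_mul, scatter]
  simp only [Matrix.mul_assoc]

lemma p₂_whitened (z : Channel N t r → ℂ) (X : Option (Fin K) → Channel N t r → ℂ)
    (hz : ∀ j, z (three j) = X none (three j)) :
    p₂ z (scatter fun k => X (some k)) = whitenedP₂ fun k j => X k (three j) := by
  have h : (fun j => z (three j)) = fun j => X none (three j) := funext hz
  rw [p₂, m₂, h]
  rfl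

lemma p₁_whitened (z : Channel N t r → ℂ) (X : Option (Fin K) → Channel N t r → ℂ)
    (μ : Fin r → ℂ) (hz : ∀ j, z (three j) = X none (three j))
    (hz2 : ∀ j, z (two j) = μ j + X none (two j)) :
    p₁ z (scatter fun k => X (some k)) =
      whitenedP₁ μ (fun k j => X k (three j), fun k j => X k (two j)) := by
  have h3 : (fun j => z (three j)) = fun j => X none (three j) := funext hz
  have h2 : (fun j => z (two j)) = μ + fun j => X none (two j) := funext hz2
  set Z₃ : Matrix (Fin (N - (t + r))) (Fin K) ℂ := Matrix.of fun i k => X (some k) (three i) with hZ₃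
  set Z₂ : Matrix (Fin r) (Fin K) ℂ := Matrix.of fun i k => X (some k) (two i) with hZ₂
  have h33 : (scatter fun k => X (some k)).submatrix three three = Z₃ * Z₃ᴴ := rfl
  have h23 : (scatter fun k => X (some k)).submatrix two three = Z₂ * Z₃ᴴ := rfl
  have h32 : (scatter fun k => X (some k)).submatrix three two = Z₃ * Z₂ᴴ := rfl
  have h22 : (scatter fun k => X (some k)).submatrix two two = Z₂ * Z₂ᴴ := rfl
  have hs : schur (scatter fun k => X (some k)) =
      Z₂ * (1 - Z₃ᴴ * (Z₃ * Z₃ᴴ)⁻¹ * Z₃) * Z₂ᴴ := by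
    rw [schur, h33, h23, h32, h22]
    simp only [Matrix.mul_sub, Matrix.sub_mul, Matrix.mul_one, Matrix.mul_assoc]
  have hr : resid z (scatter fun k => X (some k)) =
      μ + (fun j => X none (two j)) - Z₂ *ᵥ (Z₃ᴴ * (Z₃ * Z₃ᴴ)⁻¹) *ᵥ fun j => X none (three j) := by
    rw [resid, h33, h23, h2, h3, Matrix.mulVec_mulVec, Matrix.mul_assoc]
  rw [p₁, m₁, m₂, hs, hr, h33, h3]
  rfl

lemma gaussianArray_map_blocks :
    (gaussianArray (Option (Fin K)) (Channel N t r)).map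
        (fun X => ((fun k j => X k (three j) : Option (Fin K) → Fin (N - (t + r)) → ℂ),
          (fun k j => X k (two j) : Option (Fin K) → Fin r → ℂ))) =
      (gaussianArray (Option (Fin K)) (Fin (N - (t + r)))).prod
        (gaussianArray (Option (Fin K)) (Fin r)) := by
  have h1 := congrArg (Measure.map Prod.snd) (gaussianArray_map_sum (ι := Option (Fin K))
    (α := Fin t) (β := Fin r ⊕ Fin (N - (t + r))))
  rw [Measure.map_map measurable_snd (by fun_prop), Measure.map_snd_prod, measure_univ, one_smul]
    at h1
  have h2 := congrArg (Measure.map Prod.swap) (gaussianArray_map_sum (ι := Option (Fin K))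
    (α := Fin r) (β := Fin (N - (t + r))))
  rw [← h1, Measure.prod_swap, Measure.map_map (by fun_prop) (by fun_prop),
    Measure.map_map (by fun_prop) (by fun_prop)] at h2
  exact h2

lemma upperTriangular_inv_mean {A : Matrix (Fin t) (Fin t) ℂ}
    {B : Matrix (Fin t) (Fin r ⊕ Fin (N - (t + r))) ℂ} {D : Matrix (Fin r) (Fin r) ℂ}
    {E : Matrix (Fin r) (Fin (N - (t + r))) ℂ}
    {C : Matrix (Fin (N - (t + r))) (Fin (N - (t + r))) ℂ}
    (hT : IsUnit (upperTriangular A B D E C).det) (θ₁ : Fin t → ℂ) (v : Fin r → ℂ) :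
    (∀ j, ((upperTriangular A B D E C)⁻¹ *ᵥ mean θ₁ (D *ᵥ v)) (three j) = 0) ∧
      ∀ j, ((upperTriangular A B D E C)⁻¹ *ᵥ mean θ₁ (D *ᵥ v)) (two j) = v j := by
  obtain ⟨hD, hC⟩ := isUnit_det_of_upperTriangular hT
  have hTT : ∀ x, upperTriangular A B D E C *ᵥ (upperTriangular A B D E C)⁻¹ *ᵥ x = x := fun x => by
    rw [Matrix.mulVec_mulVec, Matrix.mul_nonsing_inv _ hT, Matrix.one_mulVec]
  set x := (upperTriangular A B D E C)⁻¹ *ᵥ mean θ₁ (D *ᵥ v) with hx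
  have h3 : (fun j => x (three j)) = 0 := by
    have h := upperTriangular_mulVec_three (A := A) (B := B) (D := D) (E := E) (C := C) x
    rw [hx, hTT, ← hx] at h
    refine Matrix.mulVec_injective_of_isUnit ((Matrix.isUnit_iff_isUnit_det _).mpr hC) ?_
    rw [← h, Matrix.mulVec_zero]
    rfl
  have h2 : (fun j => x (two j)) = v := by
    have h := upperTriangular_mulVec_two (A := A) (B := B) (D := D) (E := E) (C := C) x
    rw [h3, hx, hTT, ← hx, Matrix.mulVec_zero, add_zero] at h
    refine Matrix.mulVec_injective_of_isUnit ((Matrix.isUnit_iff_isUnit_det _).mpr hD) ?_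
    rw [← h]
    rfl
  exact ⟨congrFun h3, congrFun h2⟩

/-- The statistics `(p₂, p₁)` of data with mean `mean θ₁ θ₂` and noise `n k = T X k`, where `T` is
block upper triangular, depend on the last two blocks of `X` only. -/
lemma p₂_p₁_eq_whitened {A : Matrix (Fin t) (Fin t) ℂ}
    {B : Matrix (Fin t) (Fin r ⊕ Fin (N - (t + r))) ℂ} {D : Matrix (Fin r) (Fin r) ℂ}
    {E : Matrix (Fin r) (Fin (N - (t + r))) ℂ}
    {C : Matrix (Fin (N - (t + r))) (Fin (N - (t + r))) ℂ}
    (hT : IsUnit (upperTriangular A B D E C).det) (θ₁ : Fin t → ℂ) (v : Fin r → ℂ)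
    (X : Option (Fin K) → Channel N t r → ℂ)
    (hX : IsUnit (gram fun k j => X (some k) (three j)).det) :
    (p₂ (mean θ₁ (D *ᵥ v) + upperTriangular A B D E C *ᵥ X none)
        (scatter fun k => upperTriangular A B D E C *ᵥ X (some k)),
      p₁ (mean θ₁ (D *ᵥ v) + upperTriangular A B D E C *ᵥ X none)
        (scatter fun k => upperTriangular A B D E C *ᵥ X (some k))) =
      (whitenedP₂ (fun k j => X k (three j)),
        whitenedP₁ v (fun k j => X k (three j), fun k j => X k (two j))) := by
  obtain ⟨h3, h2⟩ := upperTriangular_inv_mean hT θ₁ v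
  set y := (upperTriangular A B D E C)⁻¹ *ᵥ mean θ₁ (D *ᵥ v) + X none with hy
  have hz : mean θ₁ (D *ᵥ v) + upperTriangular A B D E C *ᵥ X none =
      upperTriangular A B D E C *ᵥ y := by
    rw [hy, Matrix.mulVec_add, Matrix.mulVec_mulVec, Matrix.mul_nonsing_inv _ hT, Matrix.one_mulVec]
  have hy3 : ∀ j, y (three j) = X none (three j) := fun j => by
    rw [hy, Pi.add_apply, h3, zero_add]
  have hy2 : ∀ j, y (two j) = v j + X none (two j) := fun j => by
    rw [hy, Pi.add_apply, h2]
  have h33 : IsUnit ((scatter fun k => X (some k)).submatrix three three).det := hX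
  rw [← p₂_whitened y X hy3, ← p₁_whitened y X v hy3 hy2, hz, scatter_mulVec, p₂, p₁, m₂_congr hT,
    m₁_congr hT h33, p₂, p₁]

lemma ae_isUnit_det_gram_three (hNK : N - (t + r) ≤ K) :
    ∀ᵐ X ∂gaussianArray (Option (Fin K)) (Channel N t r),
      IsUnit (gram fun k j => X (some k) (three j)).det := by
  have h := (measurePreserving_fst (μ := gaussianArray (Option (Fin K)) (Fin (N - (t + r))))
    (ν := gaussianArray (Option (Fin K)) (Fin r))).quasiMeasurePreserving.ae
      (ae_isUnit_det_gram (K := K) (s := N - (t + r)) hNK)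
  rw [← gaussianArray_map_blocks] at h
  exact ae_of_ae_map (show Measurable fun X : Option (Fin K) → Channel N t r → ℂ =>
    ((fun k j => X k (three j) : Option (Fin K) → Fin (N - (t + r)) → ℂ),
      (fun k j => X k (two j) : Option (Fin K) → Fin r → ℂ)) by fun_prop).aemeasurable h

variable {Ω : Type*} [MeasurableSpace Ω] {P : Measure Ω} [IsProbabilityMeasure P]

/-- Whitening turns independent complex normal vectors into independent standard ones. -/
lemma exists_whitened {ι κ : Type*} [Fintype ι] [Fintype κ] [DecidableEq κ]
    {M T : Matrix κ κ ℂ} (hM : M.PosDef) (hT : IsUnit T.det) (hTM : T * Tᴴ = M)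
    {n : ι → Ω → κ → ℂ} (hP : IsProbabilityMeasure (complexNormal 0 M))
    (hn : ∀ k, HasLaw (n k) (complexNormal 0 M) P) (hind : iIndepFun n P) :
    ∃ W : Ω → ι → κ → ℂ, AEMeasurable W P ∧ P.map W = gaussianArray ι κ ∧
      ∀ ω k, T *ᵥ W ω k = n k ω := by
  have hlin : Measurable fun x : κ → ℂ => T⁻¹ *ᵥ x := by
    unfold Matrix.mulVec dotProduct
    fun_prop
  have hnm : AEMeasurable (fun ω k => n k ω) P :=
    aemeasurable_pi_lambda _ fun k => (hn k).aemeasurable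
  refine ⟨fun ω k => T⁻¹ *ᵥ n k ω,
    aemeasurable_pi_lambda _ fun k => hlin.comp_aemeasurable (hn k).aemeasurable, ?_, fun ω k => by
      rw [Matrix.mulVec_mulVec, Matrix.mul_nonsing_inv _ hT, Matrix.one_mulVec]⟩
  have hmap := complexNormal_map_inv_mulVec (Complex.le_def.mp hM.det_pos.le).1 hT hTM hP
  have h1 : P.map (fun ω k => n k ω) = Measure.pi fun _ => complexNormal 0 M := by
    rw [(iIndepFun_iff_map_fun_eq_pi_map fun k => (hn k).aemeasurable).mp hind]
    congr 1
    ext1 k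
    exact (hn k).map_eq
  have h2 := Measure.pi_map_pi (ι := ι) (μ := fun _ => complexNormal 0 M)
    (f := fun _ x => T⁻¹ *ᵥ x) (hμ := fun _ => by rw [hmap]; infer_instance)
    fun _ => hlin.aemeasurable
  have hlin' : Measurable fun (x : ι → κ → ℂ) k => T⁻¹ *ᵥ x k :=
    measurable_pi_lambda _ fun k => hlin.comp (measurable_pi_apply k)
  rw [← h1, AEMeasurable.map_map_of_aemeasurable hlin'.aemeasurable hnm, hmap] at h2
  exact h2

/-- The joint law of `(p₂, p₁)` for an arbitrary mean vector whose third block vanishes: the law of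
`p₂` is complex central beta, and `p₁` is conditionally complex noncentral beta. -/
theorem map_p₂_p₁ (hr : 1 ≤ r) (hm : t + r < N) (hK : N ≤ K)
    {M : Matrix (Channel N t r) (Channel N t r) ℂ} (hM : M.PosDef)
    (θ₁ : Fin t → ℂ) (θ₂ : Fin r → ℂ)
    {n : Option (Fin K) → Ω → Channel N t r → ℂ}
    (hn : ∀ k, HasLaw (n k) (complexNormal 0 M) P) (hind : iIndepFun n P)
    {z : Ω → Channel N t r → ℂ} (hz : ∀ ω, z ω = mean θ₁ θ₂ + n none ω)
    {S : Ω → Matrix (Channel N t r) (Channel N t r) ℂ}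
    (hS : ∀ ω, S ω = scatter fun k => n (some k) ω)
    (hL : 1 ≤ K - (N - t) + 1) :
    AEMeasurable (fun ω => (p₂ (z ω) (S ω), p₁ (z ω) (S ω))) P ∧
    P.map (fun ω => (p₂ (z ω) (S ω), p₁ (z ω) (S ω))) =
      complexBeta (K - (N - t) + r + 1) (N - t - r) 0 ⊗ₘ
        complexBetaKernel hL hr (SINR θ₂ M) := by
  obtain ⟨A, B, D, E, C, rfl⟩ := exists_upperTriangular hM
  have hT : IsUnit (upperTriangular A B D E C).det := by
    have := hM.det_pos.ne'.isUnit
    rw [Matrix.det_mul] at this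
    exact isUnit_of_mul_isUnit_left this
  obtain ⟨v, rfl⟩ : ∃ v, D *ᵥ v = θ₂ := ⟨D⁻¹ *ᵥ θ₂, by
    rw [Matrix.mulVec_mulVec, Matrix.mul_nonsing_inv _ (isUnit_det_of_upperTriangular hT).1,
      Matrix.one_mulVec]⟩
  have hprob := (hn none).map_eq ▸ Measure.isProbabilityMeasure_map (hn none).aemeasurable
  obtain ⟨W, hWm, hW, hWn⟩ := exists_whitened hM hT rfl hprob hn hind
  rw [SINR_upperTriangular hT v]
  have hFm : Measurable fun p : (Option (Fin K) → Fin (N - (t + r)) → ℂ) ×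
      (Option (Fin K) → Fin r → ℂ) => (whitenedP₂ p.1, whitenedP₁ v p) :=
    (measurable_whitenedP₂.comp measurable_fst).prodMk (measurable_whitenedP₁ v)
  have hgm : Measurable fun X : Option (Fin K) → Channel N t r → ℂ =>
      ((fun k j => X k (three j) : Option (Fin K) → Fin (N - (t + r)) → ℂ),
        (fun k j => X k (two j) : Option (Fin K) → Fin r → ℂ)) := by fun_prop
  have hdet := ae_isUnit_det_gram_three (N := N) (t := t) (r := r) (K := K) (by omega)
  rw [← hW] at hdet
  have hae := (ae_of_ae_map hWm hdet).mono fun ω hω => p₂_p₁_eq_whitened hT θ₁ v (W ω) hω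
  simp only [hWn, ← hz, ← hS] at hae
  obtain ⟨h1, h2⟩ := aemeasurable_and_map_eq_of_ae_eq_comp hWm (hFm.comp hgm) hae
  refine ⟨h1, ?_⟩
  rw [h2, hW, ← Measure.map_map hFm hgm, gaussianArray_map_blocks, Nat.sub_sub]
  exact gaussianArray_map_whitened hr (by omega) (by omega) v rfl hL (by omega) (by omega)

end Channel

end Statistics

/-! ### Consequences of the joint law -/

section Conclusion

variable {Ω : Type*} [MeasurableSpace Ω] {P : Measure Ω} {U V : Ω → ℝ}

lemma hasLaw_fst_of_map_eq_compProd (h : AEMeasurable (fun ω => (U ω, V ω)) P) {μ : Measure ℝ}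
    [SFinite μ] {κ : Kernel ℝ ℝ} [IsMarkovKernel κ]
    (hUV : P.map (fun ω => (U ω, V ω)) = μ ⊗ₘ κ) : HasLaw U μ P := by
  refine ⟨measurable_fst.comp_aemeasurable h, ?_⟩
  rw [← Measure.fst_compProd μ κ, ← hUV, Measure.fst,
    AEMeasurable.map_map_of_aemeasurable measurable_fst.aemeasurable h]
  rfl

lemma condDistrib_ae_eq_of_map_eq_compProd [IsFiniteMeasure P]
    (h : AEMeasurable (fun ω => (U ω, V ω)) P) {μ : Measure ℝ}
    [SFinite μ] {κ : Kernel ℝ ℝ} [IsMarkovKernel κ]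
    (hUV : P.map (fun ω => (U ω, V ω)) = μ ⊗ₘ κ) : condDistrib V U P =ᵐ[P.map U] κ := by
  have hV : AEMeasurable V P := measurable_snd.comp_aemeasurable h
  refine condDistrib_ae_eq_of_measure_eq_compProd U hV ?_
  rw [hUV, (hasLaw_fst_of_map_eq_compProd h hUV).map_eq]

lemma hasLaw_swap_of_map_eq_compProd {n m n' m' : ℕ} (hn : 1 ≤ n) (hm : 1 ≤ m) (hn' : 1 ≤ n')
    (hm' : 1 ≤ m') {c : ℝ} (hc : 0 ≤ c) (h : AEMeasurable (fun ω => (U ω, V ω)) P)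
    (hUV : P.map (fun ω => (U ω, V ω)) = complexBeta n' m' 0 ⊗ₘ complexBetaKernel hn hm c) :
    HasLaw (fun ω => (V ω, U ω)) (unitSquareDensity fun x y =>
      complexBetaPdf n m x * complexBetaPdf n' m' y * sinrFactor n m c x y) P := by
  refine ⟨measurable_swap.comp_aemeasurable h, ?_⟩
  rw [← compProd_complexBetaKernel_map_swap hn hm hn' hm' hc, ← hUV,
    AEMeasurable.map_map_of_aemeasurable measurable_swap.aemeasurable h]
  rfl

lemma Channel.SINR_nonneg {N t r : ℕ} {M : Matrix (Channel N t r) (Channel N t r) ℂ}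
    (hM : M.PosDef) (θ₂ : Fin r → ℂ) : 0 ≤ Channel.SINR θ₂ M := by
  obtain ⟨A, B, D, E, C, rfl⟩ := Channel.exists_upperTriangular hM
  have hT : IsUnit (Channel.upperTriangular A B D E C).det := by
    have := hM.det_pos.ne'.isUnit
    rw [Matrix.det_mul] at this
    exact isUnit_of_mul_isUnit_left this
  have hD := (Channel.isUnit_det_of_upperTriangular hT).1
  have h := Channel.SINR_upperTriangular hT (D⁻¹ *ᵥ θ₂)
  rw [Matrix.mulVec_mulVec, Matrix.mul_nonsing_inv _ hD, Matrix.one_mulVec] at h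
  rw [h]
  positivity

end Conclusion

theorem proposition2 {Ω : Type*} [MeasurableSpace Ω] (P : Measure Ω) [IsProbabilityMeasure P]
    (N t r K : ℕ) (ht : 1 ≤ t) (hr : 1 ≤ r) (hm : t + r < N) (hK : N ≤ K)
    -- covariance matrix, interference parameters under the two hypotheses, signal parameter
    (M : Matrix (Channel N t r) (Channel N t r) ℂ) (hM : M.PosDef)
    (θ₁₀ θ₁₁ : Fin t → ℂ) (θ₂ : Fin r → ℂ) (hθ₂ : θ₂ ≠ 0)
    -- iid noise vectors: index `none` is the cell under test, `some k` the secondary data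
    (n : Option (Fin K) → Ω → Channel N t r → ℂ)
    (hn : ∀ k, HasLaw (n k) (complexNormal 0 M) P) (hind : iIndepFun n P)
    -- primary data under the two hypotheses and the scatter matrix of the secondary data
    (z₀ z₁ : Ω → Channel N t r → ℂ)
    (hz₀ : ∀ ω, z₀ ω = Channel.mean θ₁₀ 0 + n none ω)
    (hz₁ : ∀ ω, z₁ ω = Channel.mean θ₁₁ θ₂ + n none ω)
    (S : Ω → Matrix (Channel N t r) (Channel N t r) ℂ)
    (hS : ∀ ω, S ω = Channel.scatter fun k => n (some k) ω) :
    -- joint densities under the two hypotheses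
    (HasLaw (fun ω => (Channel.p₁ (z₀ ω) (S ω), Channel.p₂ (z₀ ω) (S ω)))
        (unitSquareDensity fun x y =>
          complexBetaPdf (K - (N - t) + 1) r x *
            complexBetaPdf (K - (N - t) + r + 1) (N - t - r) y) P ∧
      HasLaw (fun ω => (Channel.p₁ (z₁ ω) (S ω), Channel.p₂ (z₁ ω) (S ω)))
        (unitSquareDensity fun x y =>
          complexBetaPdf (K - (N - t) + 1) r x *
            complexBetaPdf (K - (N - t) + r + 1) (N - t - r) y *
            sinrFactor (K - (N - t) + 1) r (Channel.SINR θ₂ M) x y) P) ∧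
    -- the second component has the same complex central beta law under both hypotheses
    (HasLaw (fun ω => Channel.p₂ (z₀ ω) (S ω))
        (complexBeta (K - (N - t) + r + 1) (N - t - r) 0) P ∧
      HasLaw (fun ω => Channel.p₂ (z₁ ω) (S ω))
        (complexBeta (K - (N - t) + r + 1) (N - t - r) 0) P) ∧
    -- conditional law of the first component given the second under the two hypotheses
    ((∀ᵐ y ∂(P.map fun ω => Channel.p₂ (z₀ ω) (S ω)),
        condDistrib (fun ω => Channel.p₁ (z₀ ω) (S ω)) (fun ω => Channel.p₂ (z₀ ω) (S ω)) P y =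
          complexBeta (K - (N - t) + 1) r 0) ∧
      (∀ᵐ y ∂(P.map fun ω => Channel.p₂ (z₁ ω) (S ω)),
        condDistrib (fun ω => Channel.p₁ (z₁ ω) (S ω)) (fun ω => Channel.p₂ (z₁ ω) (S ω)) P y =
          complexBeta (K - (N - t) + 1) r √(Channel.SINR θ₂ M * y))) := by
  have hL : 1 ≤ K - (N - t) + 1 := by omega
  have hr' : 1 ≤ N - t - r := by omega
  have hL' : 1 ≤ K - (N - t) + r + 1 := by omega
  have hprob := isProbabilityMeasure_complexBeta hL' hr' 0
  -- under `H₀` the mean of the second block is zero, and so is the corresponding SINR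
  have hSINR₀ : Channel.SINR (0 : Fin r → ℂ) M = 0 := by
    simp [Channel.SINR, hermForm]
  obtain ⟨ham₀, h₀⟩ := Channel.map_p₂_p₁ hr hm hK hM θ₁₀ 0 hn hind hz₀ hS hL
  obtain ⟨ham₁, h₁⟩ := Channel.map_p₂_p₁ hr hm hK hM θ₁₁ θ₂ hn hind hz₁ hS hL
  have hpos : 0 ≤ Channel.SINR θ₂ M := Channel.SINR_nonneg hM θ₂
  have hd₀ := hasLaw_swap_of_map_eq_compProd hL hr hL' hr' le_rfl ham₀ (hSINR₀ ▸ h₀)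
  simp only [sinrFactor_zero, mul_one] at hd₀
  refine ⟨⟨hd₀, hasLaw_swap_of_map_eq_compProd hL hr hL' hr' hpos ham₁ h₁⟩,
    ⟨hasLaw_fst_of_map_eq_compProd ham₀ h₀, hasLaw_fst_of_map_eq_compProd ham₁ h₁⟩, ?_, ?_⟩
  · filter_upwards [condDistrib_ae_eq_of_map_eq_compProd ham₀ h₀] with y hy
    rw [hy]
    change complexBeta _ _ √(Channel.SINR 0 M * y) = _
    rw [hSINR₀, zero_mul, Real.sqrt_zero]
  · filter_upwards [condDistrib_ae_eq_of_map_eq_compProd ham₁ h₁] with y hy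
    rw [hy]
    rfl
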